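/- For a real number $t$ and positive integers $m,a$ let $\pi(t;m,a)$ denote the number of primes $p\le t$ with $p\equiv a \pmod m$, and let $\varphi$ be Euler's totient function. There are absolute constants $C>0$ and $\epsilon_0>0$ such that for every real $\epsilon$ with $0<\epsilon<\epsilon_0$ there is $x_0=x_0(\epsilon)$ such that for all real $x\ge x_0$ $$\sum_{x^{1-\epsilon}<m\le x}\varphi(m)\left(\int_2^x\frac{\pi(t;m,1)}{(t-1)^2}\,dt\right)^2\le C\,\epsilon\log x ,$$ where $m$ runs over the positive integers in the indicated range. -/

import Mathlib

/-- `π(t; m, a)`: the number of primes `p ≤ t` with `p ≡ a (mod m)`, for real `t`. -/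
noncomputable def primeCountingAP (t : ℝ) (m a : ℕ) : ℕ :=
  ((Finset.Icc 1 ⌊t⌋₊).filter (fun p => p.Prime ∧ p ≡ a [MOD m])).card

/-!
Every prime `p = k m + 1 ≤ x` adds at most `1 / (p - 1) = 1 / (k m)` to the integral, so the
integral is at most `(1 / m) ∑ 1 / k` over the `k ≤ x` with `k m + 1` prime. Since `φ(m) ≤ m`,
expanding the square reduces the claim to a bound for the sum of `1 / (k l m)` over the triples
with `k m + 1` and `l m + 1` both prime. The diagonal `k = l` gives `O(∑ 1 / m)` with
`∑ 1 / m = O(ε log x)`. For `k < l`, Selberg's sieve, with `m` weighted by `1 / m`, bounds the sum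
over `m` by `O((ε log x + 1) (σ(q) / q)² / log² x)`, where `q = 2 k l (l - k)`. The moments of
`σ(n) / n` are bounded on logarithmic average, so the sum over `k < l` of `(σ(q) / q)² / (k l)` is
`O(log² x)`, which cancels the denominator.
-/

open Finset
open scoped ArithmeticFunction.Moebius

/-! ### The Selberg sieve upper bound -/

lemma sum_moebius_divisors_filter_dvd {e l : ℕ} (hl : Squarefree l) (he : e ∣ l) :
    ∑ d ∈ l.divisors with e ∣ d, (μ d : ℝ) = if e = l then (μ l : ℝ) else 0 := by
  obtain ⟨f, rfl⟩ := he
  have he0 : 0 < e := Nat.pos_of_ne_zero (left_ne_zero_of_mul hl.ne_zero)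
  have hmultiples : {d ∈ (e * f).divisors | e ∣ d} = f.divisors.image (e * ·) := by
    ext d
    simp only [mem_filter, Nat.mem_divisors, mem_image]
    constructor
    · rintro ⟨⟨h, -⟩, c, rfl⟩
      exact ⟨c, ⟨Nat.dvd_of_mul_dvd_mul_left he0 h, right_ne_zero_of_mul hl.ne_zero⟩, rfl⟩
    · rintro ⟨c, ⟨h, -⟩, rfl⟩
      exact ⟨⟨Nat.mul_dvd_mul_left _ h, hl.ne_zero⟩, dvd_mul_right _ _⟩
  have hmul : ∀ c ∈ f.divisors, (μ (e * c) : ℝ) = μ e * μ c := fun c hc => by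
    exact_mod_cast ArithmeticFunction.isMultiplicative_moebius.map_mul_of_coprime
      ((Nat.coprime_of_squarefree_mul hl).coprime_dvd_right (Nat.dvd_of_mem_divisors hc))
  have hsum : ∑ c ∈ f.divisors, (μ c : ℝ) = if f = 1 then 1 else 0 := by
    have := ArithmeticFunction.coe_mul_zeta_apply (f := μ) (x := f)
    rw [ArithmeticFunction.moebius_mul_coe_zeta, ArithmeticFunction.one_apply] at this
    exact_mod_cast this.symm
  rw [hmultiples, sum_image fun a _ b _ h => Nat.eq_of_mul_eq_mul_left he0 h,
    sum_congr rfl hmul, ← mul_sum, hsum]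
  by_cases hf : f = 1
  · simp [hf]
  · rw [if_neg hf, mul_zero, if_neg fun h => hf (Nat.eq_of_mul_eq_mul_left he0 (by lia))]

lemma gcd_div_mul_cancel_of_squarefree {k d l : ℕ} (hl : Squarefree l) (hdl : d ∣ l) (hkd : k ∣ d) :
    (l / k).gcd d * k = d := by
  obtain ⟨c, rfl⟩ := hdl
  obtain ⟨e, rfl⟩ := hkd
  have hk : 0 < k := Nat.pos_of_ne_zero (left_ne_zero_of_mul (left_ne_zero_of_mul hl.ne_zero))
  have hck : c.Coprime k :=
    (Nat.coprime_of_squarefree_mul hl).symm.coprime_dvd_right (dvd_mul_right k e)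
  rw [mul_assoc, Nat.mul_div_cancel_left _ hk, mul_comm k e, Nat.gcd_mul_left, hck, mul_one]

lemma eq_and_eq_of_div_eq_div_of_squarefree {d k k' l l' : ℕ} (hl : Squarefree l)
    (hl' : Squarefree l') (hdl : d ∣ l) (hdl' : d ∣ l') (hkd : k ∣ d) (hkd' : k' ∣ d)
    (h : l / k = l' / k') : l = l' ∧ k = k' := by
  have hk := gcd_div_mul_cancel_of_squarefree hl hdl hkd
  have hk' := gcd_div_mul_cancel_of_squarefree hl' hdl' hkd'
  have hd : d ≠ 0 := ne_zero_of_dvd_ne_zero hl.ne_zero hdl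
  obtain rfl : k = k' := Nat.eq_of_mul_eq_mul_left
    (Nat.pos_of_ne_zero (left_ne_zero_of_mul (hk.trans_ne hd))) (by rw [hk, h, hk'])
  rw [← Nat.div_mul_cancel (hkd.trans hdl), h, Nat.div_mul_cancel (hkd.trans hdl')]
  exact ⟨rfl, rfl⟩

section SelbergSieve

variable (s : SelbergSieve)

/-- The sifting moduli of Selberg's sieve: the divisors `d` of the product of the sifting primes
with `d ^ 2` at most the level. -/
noncomputable def selbergSupport : Finset ℕ :=
  {d ∈ s.prodPrimes.divisors | (d : ℝ) ^ 2 ≤ s.level}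

/-- The sum `S = ∑ g(l)` over the sifting moduli `l`, whose inverse is the minimum of the
quadratic form in Selberg's sieve. -/
noncomputable def selbergSum : ℝ := ∑ l ∈ selbergSupport s, s.selbergTerms l

/-- Selberg's optimal weights. They vanish outside `selbergSupport s`. -/
noncomputable def selbergWeight (d : ℕ) : ℝ :=
  (μ d : ℝ) * (s.nu d)⁻¹ * (∑ l ∈ selbergSupport s with d ∣ l, s.selbergTerms l) / selbergSum s

variable {s}

lemma mem_selbergSupport {d : ℕ} :
    d ∈ selbergSupport s ↔ d ∣ s.prodPrimes ∧ (d : ℝ) ^ 2 ≤ s.level := by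
  simp [selbergSupport, BoundingSieve.prodPrimes_ne_zero]

lemma selbergSupport_subset_divisors : selbergSupport s ⊆ s.prodPrimes.divisors :=
  filter_subset _ _

lemma mem_selbergSupport_of_dvd {d e : ℕ} (hd : d ∈ selbergSupport s) (h : e ∣ d) :
    e ∈ selbergSupport s := by
  rw [mem_selbergSupport] at hd ⊢
  have hd0 : 0 < d := (BoundingSieve.squarefree_of_dvd_prodPrimes hd.1).ne_zero.bot_lt
  refine ⟨h.trans hd.1, le_trans ?_ hd.2⟩
  gcongr
  exact Nat.le_of_dvd hd0 h

lemma one_mem_selbergSupport : 1 ∈ selbergSupport s :=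
  mem_selbergSupport.2 ⟨one_dvd _, by simpa using s.one_le_level⟩

lemma selbergTerms_pos_of_mem_selbergSupport {l : ℕ} (hl : l ∈ selbergSupport s) :
    0 < s.selbergTerms l :=
  BoundingSieve.selbergTerms_pos (mem_selbergSupport.1 hl).1

variable (s) in
lemma selbergSum_pos : 0 < selbergSum s :=
  sum_pos (fun _ => selbergTerms_pos_of_mem_selbergSupport) ⟨1, one_mem_selbergSupport⟩

lemma selbergWeight_one : selbergWeight s 1 = 1 := by
  have hfilter : {l ∈ selbergSupport s | 1 ∣ l} = selbergSupport s := by simp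
  rw [selbergWeight, hfilter, ← selbergSum, s.nu_mult.map_one]
  simp [(selbergSum_pos s).ne']

lemma selbergWeight_eq_zero_of_notMem {d : ℕ} (hd : d ∉ selbergSupport s) :
    selbergWeight s d = 0 := by
  have hempty : {l ∈ selbergSupport s | d ∣ l} = ∅ :=
    filter_eq_empty_iff.2 fun _ hl hdl => hd (mem_selbergSupport_of_dvd hl hdl)
  rw [selbergWeight, hempty, sum_empty, mul_zero, zero_div]

lemma nu_mul_selbergWeight {d : ℕ} (hd : d ∣ s.prodPrimes) :
    s.nu d * selbergWeight s d =
      (∑ l ∈ selbergSupport s, if d ∣ l then μ d * s.selbergTerms l else 0) / selbergSum s := by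
  have := BoundingSieve.nu_ne_zero hd
  rw [← sum_filter, ← mul_sum, selbergWeight]
  field_simp

lemma sum_nu_mul_selbergWeight (e : ℕ) :
    ∑ d ∈ s.prodPrimes.divisors with e ∣ d, s.nu d * selbergWeight s d =
      if e ∈ selbergSupport s then μ e * s.selbergTerms e / selbergSum s else 0 := by
  have hinner : ∀ l ∈ selbergSupport s,
      ∑ d ∈ s.prodPrimes.divisors with e ∣ d, (if d ∣ l then μ d * s.selbergTerms l else 0) =
        if e = l then μ l * s.selbergTerms l else 0 := fun l hl => by
    have hlP := (mem_selbergSupport.1 hl).1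
    rw [← sum_filter, filter_filter, ← sum_mul]
    simp_rw [and_comm (a := e ∣ _)]
    rw [← filter_filter, Nat.divisors_filter_dvd_of_dvd BoundingSieve.prodPrimes_ne_zero hlP]
    by_cases hel : e ∣ l
    · rw [sum_moebius_divisors_filter_dvd (BoundingSieve.squarefree_of_dvd_prodPrimes hlP) hel,
        ite_mul, zero_mul]
    · have hempty : {d ∈ l.divisors | e ∣ d} = ∅ :=
        filter_eq_empty_iff.2 fun d hd hed => hel (hed.trans (Nat.dvd_of_mem_divisors hd))
      rw [hempty, sum_empty, zero_mul, if_neg fun h => hel h.dvd]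
  calc ∑ d ∈ s.prodPrimes.divisors with e ∣ d, s.nu d * selbergWeight s d
      = (∑ l ∈ selbergSupport s, ∑ d ∈ s.prodPrimes.divisors with e ∣ d,
          if d ∣ l then μ d * s.selbergTerms l else 0) / selbergSum s := by
        rw [sum_comm, sum_div]
        exact sum_congr rfl fun d hd =>
          nu_mul_selbergWeight (Nat.dvd_of_mem_divisors (mem_filter.1 hd).1)
    _ = _ := by rw [sum_congr rfl hinner, sum_ite_eq, ite_div, zero_div]

lemma mainSum_lambdaSquared_selbergWeight :
    s.mainSum (BoundingSieve.lambdaSquared (selbergWeight s)) = (selbergSum s)⁻¹ := by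
  have hterm : ∀ e ∈ s.prodPrimes.divisors, (s.selbergTerms e)⁻¹ *
      (∑ d ∈ s.prodPrimes.divisors, if e ∣ d then s.nu d * selbergWeight s d else 0) ^ 2 =
        if e ∈ selbergSupport s then s.selbergTerms e / selbergSum s ^ 2 else 0 := fun e he => by
    have heP := Nat.dvd_of_mem_divisors he
    have hμ : (μ e : ℝ) ^ 2 = 1 := by
      exact_mod_cast ArithmeticFunction.moebius_sq_eq_one_of_squarefree
        (BoundingSieve.squarefree_of_dvd_prodPrimes heP)
    have := (BoundingSieve.selbergTerms_pos heP).ne'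
    rw [← sum_filter, sum_nu_mul_selbergWeight e]
    split_ifs
    · rw [div_pow, mul_pow, hμ]
      field_simp
    · simp
  have := (selbergSum_pos s).ne'
  rw [BoundingSieve.mainSum_lambdaSquared_eq_sum_mul_sum_sq, sum_congr rfl hterm, ← sum_filter,
    filter_mem_eq_inter, inter_eq_right.2 selbergSupport_subset_divisors, ← sum_div, ← selbergSum]
  field_simp

/- The expansion `1 / ν(d) = ∑_{k ∣ d} 1 / g(k)` turns `(1 / ν(d)) ∑_{d ∣ l} g(l)` into
`∑ g(l / k)`, and the map `(l, k) ↦ l / k` is injective because `gcd(l / k, d) = d / k`. -/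
lemma nu_inv_mul_sum_selbergTerms_le {d : ℕ} (hd : d ∣ s.prodPrimes) :
    (s.nu d)⁻¹ * ∑ l ∈ selbergSupport s with d ∣ l, s.selbergTerms l ≤ selbergSum s := by
  set pairs := {l ∈ selbergSupport s | d ∣ l} ×ˢ d.divisors with hpairs
  have hmem : ∀ {p}, p ∈ pairs → (p.1 ∈ selbergSupport s ∧ d ∣ p.1) ∧ p.2 ∣ d := fun hp => by
    simp only [hpairs, mem_product, mem_filter, Nat.mem_divisors] at hp
    exact ⟨hp.1, hp.2.1⟩
  have hsquarefree : ∀ {l}, l ∈ selbergSupport s → Squarefree l := fun hl =>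
    BoundingSieve.squarefree_of_dvd_prodPrimes (mem_selbergSupport.1 hl).1
  have hinj : Set.InjOn (fun p : ℕ × ℕ => p.1 / p.2) pairs := fun p hp p' hp' h =>
    Prod.ext_iff.2 <| eq_and_eq_of_div_eq_div_of_squarefree (hsquarefree (hmem hp).1.1)
      (hsquarefree (hmem hp').1.1) (hmem hp).1.2 (hmem hp').1.2 (hmem hp).2 (hmem hp').2 h
  have hquot : ∀ p ∈ pairs,
      (s.selbergTerms p.2)⁻¹ * s.selbergTerms p.1 = s.selbergTerms (p.1 / p.2) := fun p hp => by
    obtain ⟨⟨hl, hdl⟩, hkd⟩ := hmem hp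
    rw [BoundingSieve.selbergTerms_isMultiplicative.map_div_of_coprime (hkd.trans hdl),
      div_eq_inv_mul]
    · exact Nat.coprime_of_squarefree_mul <|
        (Nat.div_mul_cancel (hkd.trans hdl)).symm ▸ hsquarefree hl
    · exact (BoundingSieve.selbergTerms_pos (hkd.trans hd)).ne'
  calc (s.nu d)⁻¹ * ∑ l ∈ selbergSupport s with d ∣ l, s.selbergTerms l
      = ∑ p ∈ pairs, (s.selbergTerms p.2)⁻¹ * s.selbergTerms p.1 := by
        rw [BoundingSieve.nu_inv_eq_sum_divisors_inv_selbergTerms hd, ← sum_filter,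
          Nat.divisors_filter_dvd_of_dvd BoundingSieve.prodPrimes_ne_zero hd, sum_mul_sum,
          ← sum_product_right']
    _ = ∑ l ∈ pairs.image fun p => p.1 / p.2, s.selbergTerms l := by
        rw [sum_image hinj, sum_congr rfl hquot]
    _ ≤ selbergSum s := by
        refine sum_le_sum_of_subset_of_nonneg (image_subset_iff.2 fun p hp => ?_) fun l hl _ =>
          (selbergTerms_pos_of_mem_selbergSupport hl).le
        obtain ⟨⟨hl, hdl⟩, hkd⟩ := hmem hp
        exact mem_selbergSupport_of_dvd hl (Nat.div_dvd_of_dvd (hkd.trans hdl))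

lemma abs_selbergWeight_le_one (d : ℕ) : |selbergWeight s d| ≤ 1 := by
  by_cases hd : d ∈ selbergSupport s
  · have hdP := (mem_selbergSupport.1 hd).1
    have hμ : |(μ d : ℝ)| ≤ 1 := by exact_mod_cast ArithmeticFunction.abs_moebius_le_one
    have hnonneg : 0 ≤ (s.nu d)⁻¹ * ∑ l ∈ selbergSupport s with d ∣ l, s.selbergTerms l :=
      mul_nonneg (inv_nonneg.2 (BoundingSieve.nu_pos_of_dvd_prodPrimes hdP).le) <|
        sum_nonneg fun l hl => (selbergTerms_pos_of_mem_selbergSupport (mem_filter.1 hl).1).le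
    rw [selbergWeight, mul_assoc, abs_div, abs_mul, abs_of_nonneg hnonneg,
      abs_of_pos (selbergSum_pos s), div_le_one (selbergSum_pos s)]
    exact (mul_le_of_le_one_left hnonneg hμ).trans (nu_inv_mul_sum_selbergTerms_le hdP)
  · simp [selbergWeight_eq_zero_of_notMem hd]

lemma abs_lambdaSquared_selbergWeight_le (d : ℕ) :
    |BoundingSieve.lambdaSquared (selbergWeight s) d| ≤
      #{p ∈ selbergSupport s ×ˢ selbergSupport s | p.1.lcm p.2 = d} := by
  have hterm : ∀ p : ℕ × ℕ,
      |if d = p.1.lcm p.2 then selbergWeight s p.1 * selbergWeight s p.2 else 0| ≤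
        if p ∈ selbergSupport s ×ˢ selbergSupport s ∧ p.1.lcm p.2 = d then 1 else 0 := fun p => by
    by_cases hp : p ∈ selbergSupport s ×ˢ selbergSupport s
    · have := mul_le_one₀ (abs_selbergWeight_le_one (s := s) p.1) (abs_nonneg _)
        (abs_selbergWeight_le_one (s := s) p.2)
      simp only [hp, true_and, eq_comm (a := d)]
      split_ifs <;> simp [abs_mul, this]
    · rw [mem_product, not_and_or] at hp
      rcases hp with hp | hp <;> simp [selbergWeight_eq_zero_of_notMem hp, hp]
  rw [BoundingSieve.lambdaSquared, ← sum_product']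
  calc _ ≤ ∑ p ∈ d.divisors ×ˢ d.divisors,
        if p ∈ selbergSupport s ×ˢ selbergSupport s ∧ p.1.lcm p.2 = d then (1 : ℝ) else 0 :=
        (abs_sum_le_sum_abs _ _).trans (sum_le_sum fun p _ => hterm p)
    _ ≤ _ := by
        rw [sum_boole]
        gcongr
        exact fun p hp => mem_filter.2 (mem_filter.1 hp).2

lemma errSum_lambdaSquared_selbergWeight_le :
    s.errSum (BoundingSieve.lambdaSquared (selbergWeight s)) ≤
      ∑ d ∈ selbergSupport s, ∑ e ∈ selbergSupport s, |s.rem (d.lcm e)| := by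
  have hmaps : ∀ p ∈ selbergSupport s ×ˢ selbergSupport s,
      p.1.lcm p.2 ∈ s.prodPrimes.divisors := fun p hp => by
    rw [mem_product, mem_selbergSupport, mem_selbergSupport] at hp
    exact Nat.mem_divisors.2 ⟨Nat.lcm_dvd hp.1.1 hp.2.1, BoundingSieve.prodPrimes_ne_zero⟩
  rw [← sum_product', ← sum_fiberwise_of_maps_to hmaps, BoundingSieve.errSum]
  refine sum_le_sum fun d _ => ?_
  calc _ ≤ #{p ∈ selbergSupport s ×ˢ selbergSupport s | p.1.lcm p.2 = d} * |s.rem d| := by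
        gcongr
        exact abs_lambdaSquared_selbergWeight_le d
    _ = ∑ p ∈ selbergSupport s ×ˢ selbergSupport s with p.1.lcm p.2 = d,
          |s.rem (p.1.lcm p.2)| := by
        rw [← nsmul_eq_mul, ← sum_const]
        exact sum_congr rfl fun p hp => by rw [(mem_filter.1 hp).2]

variable (s) in
theorem siftedSum_le_selberg :
    s.siftedSum ≤ s.totalMass / selbergSum s +
      ∑ d ∈ selbergSupport s, ∑ e ∈ selbergSupport s, |s.rem (d.lcm e)| := by
  refine (BoundingSieve.siftedSum_le_mainSum_errSum_of_upperMoebius _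
    (BoundingSieve.upperMoebius_lambdaSquared (selbergWeight s) selbergWeight_one)).trans ?_
  rw [mainSum_lambdaSquared_selbergWeight, ← div_eq_mul_inv]
  gcongr
  exact errSum_lambdaSquared_selbergWeight_le

end SelbergSieve

/-! ### Equidistribution of pairs of linear forms -/

lemma abs_sum_Ioc_mul_le_of_antitoneOn {A : ℕ} {f c : ℕ → ℝ} {K : ℝ}
    (hf : AntitoneOn f (Set.Ioi A)) (hf₀ : ∀ n, A < n → 0 ≤ f n)
    (hc : ∀ n, A ≤ n → |∑ m ∈ Ioc A n, c m| ≤ K) {B : ℕ} (hAB : A ≤ B) :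
    |∑ m ∈ Ioc A B, f m * c m| ≤ K * f (A + 1) := by
  have hparts : |∑ m ∈ Ioc A B, f m * c m - f (B + 1) * ∑ m ∈ Ioc A B, c m| ≤
      K * (f (A + 1) - f (B + 1)) := by
    induction B, hAB using Nat.le_induction with
    | base => simp
    | succ B hAB ih =>
      have hstep : 0 ≤ f (B + 1) - f (B + 1 + 1) :=
        sub_nonneg.2 (hf (Set.mem_Ioi.2 (by lia)) (Set.mem_Ioi.2 (by lia)) (by lia))
      calc |∑ m ∈ Ioc A (B + 1), f m * c m - f (B + 1 + 1) * ∑ m ∈ Ioc A (B + 1), c m|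
          = |(∑ m ∈ Ioc A B, f m * c m - f (B + 1) * ∑ m ∈ Ioc A B, c m) +
              (f (B + 1) - f (B + 1 + 1)) * ∑ m ∈ Ioc A (B + 1), c m| := by
            rw [sum_Ioc_succ_top hAB, sum_Ioc_succ_top hAB]
            ring_nf
        _ ≤ K * (f (A + 1) - f (B + 1)) + (f (B + 1) - f (B + 1 + 1)) * K := by
            grw [abs_add_le, ih, abs_mul, abs_of_nonneg hstep, hc (B + 1) (by lia)]
        _ = K * (f (A + 1) - f (B + 1 + 1)) := by ring
  have hlast := mul_le_mul_of_nonneg_left (hc B hAB) (hf₀ (B + 1) (by lia))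
  rw [← abs_of_nonneg (hf₀ (B + 1) (by lia)), ← abs_mul,
    abs_of_nonneg (hf₀ (B + 1) (by lia))] at hlast
  have := abs_sub_abs_le_abs_sub (∑ m ∈ Ioc A B, f m * c m) (f (B + 1) * ∑ m ∈ Ioc A B, c m)
  linarith

lemma abs_sum_inv_filter_sub_le {A B : ℕ} {δ K : ℝ} (P : ℕ → Prop) [DecidablePred P]
    (h : ∀ n, A ≤ n → |(#{m ∈ Ioc A n | P m} : ℝ) - δ * (n - A)| ≤ K) (hAB : A ≤ B) :
    |∑ m ∈ Ioc A B with P m, (m : ℝ)⁻¹ - δ * ∑ m ∈ Ioc A B, (m : ℝ)⁻¹| ≤ K / (A + 1) := by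
  have habel := abs_sum_Ioc_mul_le_of_antitoneOn (A := A) (f := fun m => (m : ℝ)⁻¹)
    (c := fun m => (if P m then 1 else 0) - δ) (K := K)
    (fun m hm n _ hmn => by
      have : 0 < m := (Nat.zero_le A).trans_lt hm
      dsimp only
      gcongr)
    (fun _ _ => by positivity)
    (fun n hn => by
      rw [sum_sub_distrib, sum_boole, sum_const, Nat.card_Ioc, nsmul_eq_mul, Nat.cast_sub hn,
        mul_comm _ δ]
      exact h n hn) hAB
  simp only [mul_sub, mul_ite, mul_one, mul_zero, sum_sub_distrib, ← sum_filter, ← sum_mul]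
    at habel
  rw [mul_comm δ]
  simpa [div_eq_mul_inv] using habel

lemma abs_card_Ioc_filter_modEq_sub_le {A B d : ℕ} (hAB : A ≤ B) (hd : 0 < d) (v : ℕ) :
    |(#{m ∈ Ioc A B | m ≡ v [MOD d]} : ℝ) - ((B : ℝ) - A) / d| ≤ 1 := by
  have hcard := Nat.Ioc_filter_modEq_card A B hd v
  set x : ℚ := (B - v) / d with hx
  set y : ℚ := (A - v) / d with hy
  have hyx : y ≤ x := by
    rw [hx, hy]
    gcongr
  rw [max_eq_left (sub_nonneg.2 (Int.floor_mono hyx))] at hcard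
  have hcast : (#{m ∈ Ioc A B | m ≡ v [MOD d]} : ℚ) = (⌊x⌋ : ℚ) - ⌊y⌋ := by exact_mod_cast hcard
  have hxy : ((B : ℚ) - A) / d = x - y := by
    rw [hx, hy]
    ring
  have habs : |(#{m ∈ Ioc A B | m ≡ v [MOD d]} : ℚ) - ((B : ℚ) - A) / d| ≤ 1 := by
    rw [hcast, hxy, abs_le]
    constructor <;>
      linarith [Int.floor_le x, Int.floor_le y, Int.lt_floor_add_one x, Int.lt_floor_add_one y]
  have hreal := (Rat.cast_le (K := ℝ)).2 habs
  push_cast at hreal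
  exact hreal

lemma exists_forall_dvd_mul_add_one_iff_modEq {a k : ℕ} (ha : 0 < a) (hk : k.Coprime a) :
    ∃ c, ∀ m, a ∣ k * m + 1 ↔ m ≡ c [MOD a] := by
  have : NeZero a := ⟨ha.ne'⟩
  have hinv : (k : ZMod a) * (k : ZMod a)⁻¹ = 1 := ZMod.coe_mul_inv_eq_one k hk
  refine ⟨(-(k : ZMod a)⁻¹).val, fun m => ?_⟩
  rw [← ZMod.natCast_eq_natCast_iff, ← ZMod.natCast_eq_zero_iff, ZMod.natCast_zmod_val]
  push_cast
  constructor <;> intro h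
  · linear_combination (k : ZMod a)⁻¹ * h - (m : ZMod a) * hinv
  · linear_combination (k : ZMod a) * h - hinv

lemma abs_card_filter_dvd_and_dvd_sub_le {A B a b k l : ℕ} (hAB : A ≤ B) (ha : 0 < a)
    (hb : 0 < b) (hab : a.Coprime b) (hk : k.Coprime a) (hl : l.Coprime b) :
    |(#{m ∈ Ioc A B | a ∣ k * m + 1 ∧ b ∣ l * m + 1} : ℝ) - ((B : ℝ) - A) / (a * b : ℕ)| ≤ 1 := by
  obtain ⟨c, hc⟩ := exists_forall_dvd_mul_add_one_iff_modEq ha hk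
  obtain ⟨e, he⟩ := exists_forall_dvd_mul_add_one_iff_modEq hb hl
  obtain ⟨v, hvc, hve⟩ := Nat.chineseRemainder hab c e
  have hcrt : ∀ m, a ∣ k * m + 1 ∧ b ∣ l * m + 1 ↔ m ≡ v [MOD a * b] := fun m => by
    rw [hc, he, ← Nat.modEq_and_modEq_iff_modEq_mul hab]
    exact ⟨fun h => ⟨h.1.trans hvc.symm, h.2.trans hve.symm⟩,
      fun h => ⟨h.1.trans hvc, h.2.trans hve⟩⟩
  simp only [hcrt]
  exact abs_card_Ioc_filter_modEq_sub_le hAB (Nat.mul_pos ha hb) v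

lemma gcd_mul_add_one_dvd_sub (k l m : ℕ) : (k * m + 1).gcd (l * m + 1) ∣ l - k := by
  have hcop : ((k * m + 1).gcd (l * m + 1)).Coprime m :=
    Nat.Coprime.coprime_dvd_left (Nat.gcd_dvd_left _ _) (by simp)
  refine hcop.dvd_of_dvd_mul_right ?_
  have := Nat.dvd_sub (Nat.gcd_dvd_right (k * m + 1) (l * m + 1)) (Nat.gcd_dvd_left _ _)
  rwa [Nat.add_sub_add_right, ← Nat.sub_mul] at this

lemma mul_dvd_mul_and_gcd_eq_left_iff {a b u v : ℕ} (ha : 0 < a) (huv : (u.gcd v).Coprime b) :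
    a * b ∣ u * v ∧ (a * b).gcd u = a ↔ a ∣ u ∧ b ∣ v := by
  constructor
  · rintro ⟨hdvd, hgcd⟩
    obtain ⟨u, rfl⟩ : a ∣ u := hgcd ▸ Nat.gcd_dvd_right _ _
    have hcop : b.Coprime u := by
      rwa [Nat.gcd_mul_left, Nat.mul_eq_left ha.ne'] at hgcd
    rw [mul_assoc] at hdvd
    exact ⟨dvd_mul_right _ _, hcop.dvd_of_dvd_mul_left (Nat.dvd_of_mul_dvd_mul_left ha hdvd)⟩
  · rintro ⟨hau, hbv⟩
    have hcop : b.Coprime u :=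
      (huv.symm.coprime_dvd_left (Nat.gcd_dvd_left b u)).eq_one_of_dvd
        (Nat.dvd_gcd (Nat.gcd_dvd_right b u) ((Nat.gcd_dvd_left b u).trans hbv))
    exact ⟨mul_dvd_mul hau hbv, by rw [hcop.gcd_mul_right_cancel, Nat.gcd_eq_left hau]⟩

/-- The multiplicative function `d ↦ τ(d) / d`. For squarefree `d` prime to `k l (l - k)` it is the
proportion of residues `m` modulo `d` with `d ∣ (k m + 1) (l m + 1)`. -/
noncomputable def divisorDensity : ArithmeticFunction ℝ :=
  ((ArithmeticFunction.sigma 0 : ArithmeticFunction ℕ) : ArithmeticFunction ℝ).pdiv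
    ((ArithmeticFunction.id : ArithmeticFunction ℕ) : ArithmeticFunction ℝ)

lemma divisorDensity_apply (d : ℕ) : divisorDensity d = #d.divisors / d := by
  rw [divisorDensity, ArithmeticFunction.pdiv_apply, ArithmeticFunction.natCoe_apply,
    ArithmeticFunction.natCoe_apply, ArithmeticFunction.sigma_zero_apply,
    ArithmeticFunction.id_apply]

lemma isMultiplicative_divisorDensity : divisorDensity.IsMultiplicative :=
  ArithmeticFunction.isMultiplicative_sigma.natCast.pdiv
    ArithmeticFunction.isMultiplicative_id.natCast

lemma abs_card_filter_dvd_mul_sub_le {A B k l d : ℕ} (hAB : A ≤ B)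
    (hd : Squarefree d) (hk : k.Coprime d) (hl : l.Coprime d) (hlk : (l - k).Coprime d) :
    |(#{m ∈ Ioc A B | d ∣ (k * m + 1) * (l * m + 1)} : ℝ) - divisorDensity d * (B - A)| ≤
      #d.divisors := by
  have hfiber : ∀ a ∈ d.divisors,
      {m ∈ {m ∈ Ioc A B | d ∣ (k * m + 1) * (l * m + 1)} | d.gcd (k * m + 1) = a} =
        {m ∈ Ioc A B | a ∣ k * m + 1 ∧ d / a ∣ l * m + 1} := fun a ha => by
    obtain ⟨b, rfl⟩ := Nat.dvd_of_mem_divisors ha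
    have ha0 := Nat.pos_of_mem_divisors ha
    rw [filter_filter, Nat.mul_div_cancel_left _ ha0]
    exact filter_congr fun m _ => mul_dvd_mul_and_gcd_eq_left_iff ha0 <|
      (hlk.coprime_dvd_left (gcd_mul_add_one_dvd_sub k l m)).coprime_dvd_right (dvd_mul_left b a)
  have hcard : #{m ∈ Ioc A B | d ∣ (k * m + 1) * (l * m + 1)} =
      ∑ a ∈ d.divisors, #{m ∈ Ioc A B | a ∣ k * m + 1 ∧ d / a ∣ l * m + 1} := by
    rw [card_eq_sum_card_fiberwise (f := fun m => d.gcd (k * m + 1)) (t := d.divisors)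
      fun m _ => by simp [hd.ne_zero, Nat.gcd_dvd_left]]
    exact sum_congr rfl fun a ha => by rw [hfiber a ha]
  have hmain : divisorDensity d * (B - A) = ∑ _a ∈ d.divisors, ((B : ℝ) - A) / d := by
    rw [sum_const, nsmul_eq_mul, divisorDensity_apply]
    ring
  rw [hcard, hmain, Nat.cast_sum, ← sum_sub_distrib, ← mul_one (#d.divisors : ℝ), ← nsmul_eq_mul]
  refine (abs_sum_le_sum_abs _ _).trans (sum_le_card_nsmul _ _ _ fun a ha => ?_)
  obtain ⟨b, rfl⟩ := Nat.dvd_of_mem_divisors ha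
  have ha0 := Nat.pos_of_mem_divisors ha
  rw [Nat.mul_div_cancel_left _ ha0]
  exact abs_card_filter_dvd_and_dvd_sub_le hAB ha0
    (Nat.pos_of_ne_zero (right_ne_zero_of_mul hd.ne_zero)) (Nat.coprime_of_squarefree_mul hd)
    (hk.coprime_dvd_right (dvd_mul_right _ _)) (hl.coprime_dvd_right (dvd_mul_left _ _))

/-! ### The sieve for prime pairs -/

lemma sum_image_ite_sum_fiber {α β M : Type*} [AddCommMonoid M] [DecidableEq β] (s : Finset α)
    (F : α → β) (f : α → M) (P : β → Prop) [DecidablePred P] :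
    ∑ b ∈ s.image F, (if P b then ∑ a ∈ s with F a = b, f a else 0) =
      ∑ a ∈ s with P (F a), f a := by
  rw [sum_filter, ← sum_fiberwise_of_maps_to (fun a ha => mem_image_of_mem F ha)]
  refine sum_congr rfl fun b _ => ?_
  split_ifs with hb
  · exact sum_congr rfl fun a ha => by rw [if_pos ((mem_filter.1 ha).2 ▸ hb)]
  · exact (sum_eq_zero fun a ha => by rw [if_neg ((mem_filter.1 ha).2 ▸ hb)]).symm

/-- The product of the primes up to `R` that do not divide `q`. -/
def primorialCoprimeTo (q R : ℕ) : ℕ := ∏ p ∈ Icc 1 R with p.Prime ∧ ¬ p ∣ q, p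

lemma squarefree_primorialCoprimeTo (q R : ℕ) : Squarefree (primorialCoprimeTo q R) := by
  refine Finset.squarefree_prod_of_pairwise_isCoprime (fun p hp p' hp' hne => ?_)
    fun p hp => (mem_filter.1 hp).2.1.squarefree
  exact Nat.coprime_iff_isRelPrime.1 <|
    (Nat.coprime_primes (mem_filter.1 hp).2.1 (mem_filter.1 hp').2.1).2 hne

lemma prime_dvd_primorialCoprimeTo_iff {p q R : ℕ} (hp : p.Prime) :
    p ∣ primorialCoprimeTo q R ↔ p ≤ R ∧ ¬ p ∣ q := by
  rw [primorialCoprimeTo, hp.prime.dvd_finsetProd_iff]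
  constructor
  · rintro ⟨p', hp', hdvd⟩
    simp only [mem_filter, mem_Icc] at hp'
    obtain rfl := (Nat.prime_dvd_prime_iff_eq hp hp'.2.1).1 hdvd
    exact ⟨hp'.1.2, hp'.2.2⟩
  · rintro ⟨hpR, hpq⟩
    exact ⟨p, mem_filter.2 ⟨mem_Icc.2 ⟨hp.one_le, hpR⟩, hp, hpq⟩, dvd_rfl⟩

lemma coprime_of_dvd_primorialCoprimeTo {d q R : ℕ} (hd : d ∣ primorialCoprimeTo q R) :
    d.Coprime q :=
  Nat.coprime_of_dvd fun _ hp hpd => ((prime_dvd_primorialCoprimeTo_iff hp).1 (hpd.trans hd)).2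

lemma dvd_primorialCoprimeTo {d q R : ℕ} (hd : Squarefree d) (hdR : d ≤ R) (hdq : d.Coprime q) :
    d ∣ primorialCoprimeTo q R := by
  rw [← Nat.prod_primeFactors_of_squarefree hd, primorialCoprimeTo]
  refine prod_dvd_prod_of_subset _ _ _ fun p hp => ?_
  have hpp := Nat.prime_of_mem_primeFactors hp
  have hpd := Nat.dvd_of_mem_primeFactors hp
  exact mem_filter.2 ⟨mem_Icc.2 ⟨hpp.one_le, (Nat.le_of_dvd hd.ne_zero.bot_lt hpd).trans hdR⟩, hpp,
    fun hpq => hpp.one_lt.ne' (Nat.eq_one_of_dvd_coprimes hdq hpd hpq)⟩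

lemma divisorDensity_prime {p : ℕ} (hp : p.Prime) : divisorDensity p = 2 / p := by
  rw [divisorDensity_apply, ← ArithmeticFunction.sigma_zero_apply]
  simp [ArithmeticFunction.sigma_zero_apply, hp.divisors, hp.one_lt.ne]

/-- A number divisible by `2` and by every prime modulo which the forms `k m + 1` and `l m + 1` do
not have two distinct roots: the primes to be left out when sieving the pair. It is meant for
`k < l`. -/
def pairModulus (k l : ℕ) : ℕ := 2 * (k * l * (l - k))

lemma coprime_of_coprime_pairModulus {d k l : ℕ} (h : d.Coprime (pairModulus k l)) :
    k.Coprime d ∧ l.Coprime d ∧ (l - k).Coprime d := by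
  simp only [pairModulus, Nat.coprime_mul_iff_right] at h
  exact ⟨h.2.1.1.symm, h.2.1.2.symm, h.2.2.symm⟩

/-- The sieve of level `R ^ 2` by the primes up to `R` for the values `(k m + 1) (l m + 1)` with
`A < m ≤ B`, where `m` carries the weight `1 / m`. -/
noncomputable def primePairSieve (A B k l : ℕ) {R : ℕ} (hR : 1 ≤ R) : SelbergSieve where
  support := (Ioc A B).image fun m => (k * m + 1) * (l * m + 1)
  prodPrimes := primorialCoprimeTo (pairModulus k l) R
  prodPrimes_squarefree := squarefree_primorialCoprimeTo _ _
  weights n := ∑ m ∈ Ioc A B with (k * m + 1) * (l * m + 1) = n, (m : ℝ)⁻¹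
  weights_nonneg _ := sum_nonneg fun _ _ => by positivity
  totalMass := ∑ m ∈ Ioc A B, (m : ℝ)⁻¹
  nu := divisorDensity
  nu_mult := isMultiplicative_divisorDensity
  nu_pos_of_prime p hp _ := by
    have := hp.pos
    rw [divisorDensity_prime hp]
    positivity
  nu_lt_one_of_prime p hp hdvd := by
    have h2 : p ≠ 2 := fun h =>
      ((prime_dvd_primorialCoprimeTo_iff hp).1 hdvd).2 (h ▸ dvd_mul_right _ _)
    rw [divisorDensity_prime hp, div_lt_one (by exact_mod_cast hp.pos)]
    exact_mod_cast hp.two_le.lt_of_ne' h2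
  level := (R : ℝ) ^ 2
  one_le_level := one_le_pow₀ (by exact_mod_cast hR)

section PrimePairSieve

variable {A B k l R : ℕ} (hR : 1 ≤ R)

lemma siftedSum_primePairSieve :
    (primePairSieve A B k l hR).siftedSum =
      ∑ m ∈ Ioc A B with
        (primorialCoprimeTo (pairModulus k l) R).Coprime ((k * m + 1) * (l * m + 1)),
        (m : ℝ)⁻¹ :=
  sum_image_ite_sum_fiber _ _ _ fun n => (primorialCoprimeTo (pairModulus k l) R).Coprime n

lemma coprime_primorialCoprimeTo_of_prime {p q : ℕ} (hp : p.Prime) (hRp : R < p) :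
    (primorialCoprimeTo q R).Coprime p :=
  ((Nat.Prime.coprime_iff_not_dvd hp).2 fun h =>
    hRp.not_ge ((prime_dvd_primorialCoprimeTo_iff hp).1 h).1).symm

lemma sum_inv_prime_pair_le_siftedSum (hk : 0 < k) (hl : 0 < l) (hRA : R ≤ A) :
    ∑ m ∈ Ioc A B with (k * m + 1).Prime ∧ (l * m + 1).Prime, (m : ℝ)⁻¹ ≤
      (primePairSieve A B k l hR).siftedSum := by
  rw [siftedSum_primePairSieve]
  refine sum_le_sum_of_subset_of_nonneg (fun m hm => ?_) fun _ _ _ => by positivity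
  simp only [mem_filter, mem_Ioc] at hm ⊢
  obtain ⟨hmAB, hpk, hpl⟩ := hm
  have hkm : m ≤ k * m := Nat.le_mul_of_pos_left m hk
  have hlm : m ≤ l * m := Nat.le_mul_of_pos_left m hl
  exact ⟨hmAB, (coprime_primorialCoprimeTo_of_prime hpk (by lia)).mul_right
    (coprime_primorialCoprimeTo_of_prime hpl (by lia))⟩

lemma abs_rem_primePairSieve_le {d : ℕ} (hAB : A ≤ B)
    (hd : d ∣ (primePairSieve A B k l hR).prodPrimes) :
    |(primePairSieve A B k l hR).rem d| ≤ #d.divisors / (A + 1) := by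
  have hmult : (primePairSieve A B k l hR).multSum d =
      ∑ m ∈ Ioc A B with d ∣ (k * m + 1) * (l * m + 1), (m : ℝ)⁻¹ :=
    sum_image_ite_sum_fiber _ _ _ fun n => d ∣ n
  obtain ⟨hk, hl, hlk⟩ :=
    coprime_of_coprime_pairModulus (coprime_of_dvd_primorialCoprimeTo hd)
  rw [BoundingSieve.rem, hmult]
  exact abs_sum_inv_filter_sub_le _ (fun n hn => abs_card_filter_dvd_mul_sub_le hn
    (BoundingSieve.squarefree_of_dvd_prodPrimes hd) hk hl hlk) hAB

lemma mem_Icc_of_mem_selbergSupport_primePairSieve {d : ℕ}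
    (hd : d ∈ selbergSupport (primePairSieve A B k l hR)) : d ∈ Icc 1 R := by
  obtain ⟨hdP, hlevel⟩ := mem_selbergSupport.1 hd
  have hd0 := (BoundingSieve.squarefree_of_dvd_prodPrimes hdP).ne_zero
  have hdR : (d : ℝ) ≤ R := le_of_sq_le_sq hlevel (by positivity)
  exact mem_Icc.2 ⟨Nat.one_le_iff_ne_zero.2 hd0, by exact_mod_cast hdR⟩

lemma abs_rem_lcm_primePairSieve_le {d e : ℕ} (hAB : A ≤ B)
    (hd : d ∈ selbergSupport (primePairSieve A B k l hR))
    (he : e ∈ selbergSupport (primePairSieve A B k l hR)) :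
    |(primePairSieve A B k l hR).rem (d.lcm e)| ≤ (R : ℝ) ^ 2 / (A + 1) := by
  have hlcm : d.lcm e ∣ (primePairSieve A B k l hR).prodPrimes :=
    Nat.lcm_dvd (mem_selbergSupport.1 hd).1 (mem_selbergSupport.1 he).1
  have hdR := mem_Icc.1 (mem_Icc_of_mem_selbergSupport_primePairSieve hR hd)
  have heR := mem_Icc.1 (mem_Icc_of_mem_selbergSupport_primePairSieve hR he)
  have hcard : #(d.lcm e).divisors ≤ R ^ 2 :=
    calc #(d.lcm e).divisors ≤ d.lcm e := Nat.card_divisors_le_self _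
      _ ≤ d * e := Nat.le_of_dvd (Nat.mul_pos hdR.1 heR.1) (Nat.lcm_dvd_mul d e)
      _ ≤ R ^ 2 := by rw [sq]; exact Nat.mul_le_mul hdR.2 heR.2
  refine (abs_rem_primePairSieve_le hR hAB hlcm).trans ?_
  gcongr
  exact_mod_cast hcard

theorem sum_inv_prime_pair_le_div_selbergSum (hk : 0 < k) (hl : 0 < l) (hRA : R ≤ A)
    (hAB : A ≤ B) :
    ∑ m ∈ Ioc A B with (k * m + 1).Prime ∧ (l * m + 1).Prime, (m : ℝ)⁻¹ ≤
      (∑ m ∈ Ioc A B, (m : ℝ)⁻¹) / selbergSum (primePairSieve A B k l hR) +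
        (R : ℝ) ^ 4 / (A + 1) := by
  set D := selbergSupport (primePairSieve A B k l hR) with hD
  have hcard : #D ≤ R := by
    simpa using card_le_card
      fun _ => mem_Icc_of_mem_selbergSupport_primePairSieve (A := A) (B := B) (k := k) (l := l) hR
  have herr : ∑ d ∈ D, ∑ e ∈ D, |(primePairSieve A B k l hR).rem (d.lcm e)| ≤
      (R : ℝ) ^ 4 / (A + 1) :=
    calc _ ≤ ∑ _d ∈ D, ∑ _e ∈ D, (R : ℝ) ^ 2 / (A + 1) := sum_le_sum fun d hd =>
          sum_le_sum fun e he => abs_rem_lcm_primePairSieve_le hR hAB hd he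
      _ = (#D : ℝ) * #D * ((R : ℝ) ^ 2 / (A + 1)) := by simp [mul_assoc]
      _ ≤ (R : ℝ) * R * ((R : ℝ) ^ 2 / (A + 1)) := by gcongr
      _ = (R : ℝ) ^ 4 / (A + 1) := by ring
  calc _ ≤ (primePairSieve A B k l hR).siftedSum :=
        sum_inv_prime_pair_le_siftedSum hR hk hl hRA
    _ ≤ _ := (siftedSum_le_selberg _).trans (add_le_add_right herr _)

end PrimePairSieve

/-! ### The singular factor -/

lemma sum_le_sum_comp_of_subset_image {α β M : Type*} [DecidableEq α] [AddCommMonoid M]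
    [PartialOrder M] [IsOrderedAddMonoid M] {s : Finset α} {t : Finset β} {g : β → α} (f : α → M)
    (hf : ∀ b ∈ t, 0 ≤ f (g b)) (h : s ⊆ t.image g) :
    ∑ a ∈ s, f a ≤ ∑ b ∈ t, f (g b) := by
  have hnonneg : ∀ a ∈ t.image g, 0 ≤ f a := forall_mem_image.2 hf
  calc ∑ a ∈ s, f a ≤ ∑ a ∈ t.image g, f a :=
        sum_le_sum_of_subset_of_nonneg h fun a ha _ => hnonneg a ha
    _ ≤ ∑ a ∈ t.image g, ∑ b ∈ t with g b = a, f (g b) := sum_le_sum fun a ha => by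
        obtain ⟨b, hb, rfl⟩ := mem_image.1 ha
        exact single_le_sum (f := fun b => f (g b)) (fun b' hb' => hf b' (mem_filter.1 hb').1)
          (mem_filter.2 ⟨hb, rfl⟩)
    _ = ∑ b ∈ t, f (g b) := sum_fiberwise_of_maps_to (fun b hb => mem_image_of_mem g hb) _

lemma sum_Icc_inv_sq_le_two (r : ℕ) : ∑ b ∈ Icc 1 r, ((b : ℝ) ^ 2)⁻¹ ≤ 2 := by
  have hIoo : Icc 1 r = Ioo 0 (r + 1) := by ext; simp only [mem_Icc, mem_Ioo]; lia
  rw [hIoo]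
  simpa using sum_Ioo_inv_sq_le (α := ℝ) 0 (r + 1)

lemma log_le_sum_inv_Icc (r : ℕ) : Real.log r ≤ ∑ n ∈ Icc 1 r, (n : ℝ)⁻¹ := by
  have h := log_add_one_le_harmonic r
  rw [harmonic_eq_sum_Icc] at h
  push_cast at h
  refine le_trans ?_ h
  rcases Nat.eq_zero_or_pos r with rfl | hr
  · simp
  · gcongr
    linarith

/-- The abundancy index `σ(n) / n` of `n`, as the sum of the inverses of its divisors. -/
noncomputable def abundancyIndex (n : ℕ) : ℝ := ∑ d ∈ n.divisors, (d : ℝ)⁻¹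

lemma abundancyIndex_nonneg (n : ℕ) : 0 ≤ abundancyIndex n := sum_nonneg fun _ _ => by positivity

/-- The squarefree integers between `1` and `r` that are coprime to `q`. -/
def squarefreeCoprimeTo (q r : ℕ) : Finset ℕ := {d ∈ Icc 1 r | Squarefree d ∧ d.Coprime q}

lemma mem_squarefreeCoprimeTo {q r d : ℕ} :
    d ∈ squarefreeCoprimeTo q r ↔ (0 < d ∧ d ≤ r) ∧ Squarefree d ∧ d.Coprime q := by
  simp [squarefreeCoprimeTo, Nat.succ_le_iff]

lemma mem_squarefreeCoprimeTo_of_dvd {q r d e : ℕ} (hd : d ∈ squarefreeCoprimeTo q r)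
    (h : e ∣ d) : e ∈ squarefreeCoprimeTo q r := by
  rw [mem_squarefreeCoprimeTo] at hd ⊢
  exact ⟨⟨Nat.pos_of_dvd_of_pos h hd.1.1, (Nat.le_of_dvd hd.1.1 h).trans hd.1.2⟩,
    hd.2.1.squarefree_of_dvd h, hd.2.2.coprime_dvd_left h⟩

lemma exists_eq_sq_mul_dvd_mul_squarefree_coprime (n q : ℕ) :
    ∃ b u v, n = b ^ 2 * (u * v) ∧ u ∣ q ∧ Squarefree v ∧ v.Coprime q := by
  obtain ⟨a, b, rfl, ha⟩ := Nat.sq_mul_squarefree n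
  obtain ⟨v, hv⟩ := Nat.gcd_dvd_left a q
  refine ⟨b, a.gcd q, v, by rw [← hv], Nat.gcd_dvd_right _ _,
    ha.squarefree_of_dvd (Dvd.intro_left _ hv.symm), Nat.coprime_of_dvd fun p hp hpv hpq => ?_⟩
  have hpa : p ∣ a := hpv.trans (Dvd.intro_left _ hv.symm)
  have hsq : p * p ∣ a := by
    rw [hv]
    exact mul_dvd_mul (Nat.dvd_gcd hpa hpq) hpv
  exact hp.one_lt.ne' (Nat.isUnit_iff.1 (ha p hsq))

lemma sum_inv_Icc_le_abundancyIndex_mul {q : ℕ} (hq : q ≠ 0) (r : ℕ) :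
    ∑ n ∈ Icc 1 r, (n : ℝ)⁻¹ ≤
      2 * abundancyIndex q * ∑ d ∈ squarefreeCoprimeTo q r, (d : ℝ)⁻¹ := by
  have hcover : Icc 1 r ⊆ (Icc 1 r ×ˢ (q.divisors ×ˢ squarefreeCoprimeTo q r)).image
      fun p => p.1 ^ 2 * (p.2.1 * p.2.2) := fun n hn => by
    obtain ⟨hn0, hnr⟩ := mem_Icc.1 hn
    obtain ⟨b, u, v, rfl, hu, hv, hvq⟩ := exists_eq_sq_mul_dvd_mul_squarefree_coprime n q
    have hbr := (Nat.le_of_dvd hn0 ((dvd_pow_self b two_ne_zero).mul_right _)).trans hnr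
    have hvr := (Nat.le_of_dvd hn0 ((dvd_mul_left v u).mul_left _)).trans hnr
    have hb0 : 0 < b := Nat.pos_of_ne_zero (by rintro rfl; simp at hn0)
    refine mem_image.2 ⟨(b, u, v), ?_, rfl⟩
    simp only [mem_product, mem_Icc, Nat.mem_divisors, mem_squarefreeCoprimeTo]
    exact ⟨⟨hb0, hbr⟩, ⟨hu, hq⟩, ⟨hv.ne_zero.bot_lt, hvr⟩, hv, hvq⟩
  have : 0 ≤ ∑ d ∈ squarefreeCoprimeTo q r, (d : ℝ)⁻¹ := sum_nonneg fun _ _ => by positivity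
  have hs := abundancyIndex_nonneg q
  calc ∑ n ∈ Icc 1 r, (n : ℝ)⁻¹
      ≤ ∑ p ∈ Icc 1 r ×ˢ (q.divisors ×ˢ squarefreeCoprimeTo q r),
          ((p.1 ^ 2 * (p.2.1 * p.2.2) : ℕ) : ℝ)⁻¹ :=
        sum_le_sum_comp_of_subset_image (fun n : ℕ => (n : ℝ)⁻¹) (fun _ _ => by positivity) hcover
    _ = (∑ b ∈ Icc 1 r, ((b : ℝ) ^ 2)⁻¹) *
          (abundancyIndex q * ∑ d ∈ squarefreeCoprimeTo q r, (d : ℝ)⁻¹) := by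
        rw [abundancyIndex, sum_mul_sum, ← sum_product', sum_mul_sum, ← sum_product']
        push_cast
        simp only [mul_inv]
    _ ≤ 2 * (abundancyIndex q * ∑ d ∈ squarefreeCoprimeTo q r, (d : ℝ)⁻¹) := by
        grw [sum_Icc_inv_sq_le_two]
    _ = 2 * abundancyIndex q * ∑ d ∈ squarefreeCoprimeTo q r, (d : ℝ)⁻¹ := (mul_assoc _ _ _).symm

/-- The pairs of coprime elements of `squarefreeCoprimeTo q r`. -/
def squarefreeCoprimePairs (q r : ℕ) : Finset (ℕ × ℕ) :=
  {p ∈ squarefreeCoprimeTo q r ×ˢ squarefreeCoprimeTo q r | p.1.Coprime p.2}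

lemma sq_sum_squarefreeCoprimeTo_le (q r : ℕ) :
    (∑ d ∈ squarefreeCoprimeTo q r, (d : ℝ)⁻¹) ^ 2 ≤
      2 * ∑ p ∈ squarefreeCoprimePairs q r, ((p.1 : ℝ) * p.2)⁻¹ := by
  have hcover : squarefreeCoprimeTo q r ×ˢ squarefreeCoprimeTo q r ⊆
      (Icc 1 r ×ˢ squarefreeCoprimePairs q r).image
        fun p => (p.1 * p.2.1, p.1 * p.2.2) := fun ⟨a, b⟩ hab => by
    obtain ⟨ha, hb⟩ := mem_product.1 hab
    have ha' := mem_squarefreeCoprimeTo.1 ha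
    have hg0 : 0 < a.gcd b := Nat.gcd_pos_of_pos_left _ ha'.1.1
    have hga := Nat.gcd_dvd_left a b
    have hgb := Nat.gcd_dvd_right a b
    refine mem_image.2 ⟨(a.gcd b, a / a.gcd b, b / a.gcd b), ?_, ?_⟩
    · simp only [squarefreeCoprimePairs, mem_product, mem_Icc, mem_filter]
      exact ⟨⟨hg0, (Nat.le_of_dvd ha'.1.1 hga).trans ha'.1.2⟩,
        ⟨mem_squarefreeCoprimeTo_of_dvd ha (Nat.div_dvd_of_dvd hga),
          mem_squarefreeCoprimeTo_of_dvd hb (Nat.div_dvd_of_dvd hgb)⟩,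
        Nat.coprime_div_gcd_div_gcd hg0⟩
    · simp only [Nat.mul_div_cancel' hga, Nat.mul_div_cancel' hgb]
  calc (∑ d ∈ squarefreeCoprimeTo q r, (d : ℝ)⁻¹) ^ 2
      = ∑ p ∈ squarefreeCoprimeTo q r ×ˢ squarefreeCoprimeTo q r, ((p.1 : ℝ) * p.2)⁻¹ := by
        rw [sq, sum_mul_sum, ← sum_product']
        simp only [mul_inv]
    _ ≤ ∑ p ∈ Icc 1 r ×ˢ squarefreeCoprimePairs q r,
          (((p.1 * p.2.1 : ℕ) : ℝ) * (p.1 * p.2.2 : ℕ))⁻¹ :=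
        sum_le_sum_comp_of_subset_image (fun p : ℕ × ℕ => ((p.1 : ℝ) * p.2)⁻¹)
          (fun _ _ => by positivity) hcover
    _ = (∑ b ∈ Icc 1 r, ((b : ℝ) ^ 2)⁻¹) *
          ∑ p ∈ squarefreeCoprimePairs q r, ((p.1 : ℝ) * p.2)⁻¹ := by
        rw [sum_mul_sum, ← sum_product']
        refine sum_congr rfl fun p _ => ?_
        rw [← mul_inv]
        push_cast
        ring
    _ ≤ 2 * ∑ p ∈ squarefreeCoprimePairs q r, ((p.1 : ℝ) * p.2)⁻¹ := by
        have : 0 ≤ ∑ p ∈ squarefreeCoprimePairs q r, ((p.1 : ℝ) * p.2)⁻¹ :=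
          sum_nonneg fun _ _ => by positivity
        grw [sum_Icc_inv_sq_le_two]

lemma sum_squarefreeCoprimePairs_le_sum_divisorDensity (q r : ℕ) :
    ∑ p ∈ squarefreeCoprimePairs q r, ((p.1 : ℝ) * p.2)⁻¹ ≤
      ∑ d ∈ squarefreeCoprimeTo q (r ^ 2), divisorDensity d := by
  have hmaps : ∀ p ∈ squarefreeCoprimePairs q r, p.1 * p.2 ∈ squarefreeCoprimeTo q (r ^ 2) :=
    fun p hp => by
      simp only [squarefreeCoprimePairs, mem_filter, mem_product, mem_squarefreeCoprimeTo] at hp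
      obtain ⟨⟨⟨⟨h1, h1r⟩, hs1, hc1⟩, ⟨h2, h2r⟩, hs2, hc2⟩, hcop⟩ := hp
      exact mem_squarefreeCoprimeTo.2 ⟨⟨Nat.mul_pos h1 h2, sq r ▸ Nat.mul_le_mul h1r h2r⟩,
        (Nat.squarefree_mul hcop).2 ⟨hs1, hs2⟩, hc1.mul_left hc2⟩
  rw [← sum_fiberwise_of_maps_to hmaps]
  refine sum_le_sum fun d hd => ?_
  have hd0 : d ≠ 0 := (mem_squarefreeCoprimeTo.1 hd).1.1.ne'
  have hfiber : {p ∈ squarefreeCoprimePairs q r | p.1 * p.2 = d} ⊆ d.divisorsAntidiagonal :=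
    fun p hp => Nat.mem_divisorsAntidiagonal.2 ⟨(mem_filter.1 hp).2, hd0⟩
  calc _ = ∑ p ∈ squarefreeCoprimePairs q r with p.1 * p.2 = d, (d : ℝ)⁻¹ :=
        sum_congr rfl fun p hp => by rw [← Nat.cast_mul, (mem_filter.1 hp).2]
    _ ≤ ∑ _p ∈ d.divisorsAntidiagonal, (d : ℝ)⁻¹ :=
        sum_le_sum_of_subset_of_nonneg hfiber fun _ _ _ => by positivity
    _ = divisorDensity d := by
        rw [sum_const, nsmul_eq_mul, divisorDensity_apply, div_eq_mul_inv,
          ← Nat.map_div_right_divisors, card_map]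

lemma log_sq_le_abundancyIndex_sq_mul {q r : ℕ} (hq : q ≠ 0) :
    Real.log r ^ 2 ≤
      8 * abundancyIndex q ^ 2 * ∑ d ∈ squarefreeCoprimeTo q (r ^ 2), divisorDensity d := by
  set V := ∑ d ∈ squarefreeCoprimeTo q r, (d : ℝ)⁻¹
  have hlog : Real.log r ≤ 2 * abundancyIndex q * V :=
    (log_le_sum_inv_Icc r).trans (sum_inv_Icc_le_abundancyIndex_mul hq r)
  have hV2 : V ^ 2 ≤ 2 * ∑ d ∈ squarefreeCoprimeTo q (r ^ 2), divisorDensity d :=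
    (sq_sum_squarefreeCoprimeTo_le q r).trans
      (by grw [sum_squarefreeCoprimePairs_le_sum_divisorDensity])
  have := Real.log_natCast_nonneg r
  calc Real.log r ^ 2 ≤ (2 * abundancyIndex q * V) ^ 2 := by gcongr
    _ = 4 * abundancyIndex q ^ 2 * V ^ 2 := by ring
    _ ≤ 4 * abundancyIndex q ^ 2 *
          (2 * ∑ d ∈ squarefreeCoprimeTo q (r ^ 2), divisorDensity d) := by gcongr
    _ = _ := by ring

lemma nu_le_selbergTerms {s : BoundingSieve} {d : ℕ} (hd : d ∣ s.prodPrimes) :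
    s.nu d ≤ s.selbergTerms d := by
  have hfactor : ∀ p ∈ d.primeFactors, 1 ≤ (1 - s.nu p)⁻¹ := fun p hp => by
    have hpp := Nat.prime_of_mem_primeFactors hp
    have hpP := (Nat.dvd_of_mem_primeFactors hp).trans hd
    exact (one_le_inv₀ (sub_pos.2 (s.nu_lt_one_of_prime p hpp hpP))).2
      (sub_le_self _ (s.nu_pos_of_prime p hpp hpP).le)
  rw [BoundingSieve.selbergTerms_apply]
  exact le_mul_of_one_le_right (BoundingSieve.nu_pos_of_dvd_prodPrimes hd).le
    (one_le_prod hfactor)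

lemma pairModulus_ne_zero {k l : ℕ} (hk : 0 < k) (hkl : k < l) : pairModulus k l ≠ 0 := by
  have := hk.trans hkl
  have := Nat.sub_pos_of_lt hkl
  unfold pairModulus
  positivity

lemma sum_divisorDensity_le_selbergSum {A B k l R : ℕ} (hR : 1 ≤ R) :
    ∑ d ∈ squarefreeCoprimeTo (pairModulus k l) R, divisorDensity d ≤
      selbergSum (primePairSieve A B k l hR) := by
  have hdvd : ∀ d ∈ squarefreeCoprimeTo (pairModulus k l) R,
      d ∣ (primePairSieve A B k l hR).prodPrimes := fun d hd => by
    obtain ⟨⟨-, hdR⟩, hsq, hcop⟩ := mem_squarefreeCoprimeTo.1 hd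
    exact dvd_primorialCoprimeTo hsq hdR hcop
  refine (sum_le_sum fun d hd => nu_le_selbergTerms (hdvd d hd)).trans <|
    sum_le_sum_of_subset_of_nonneg (fun d hd => mem_selbergSupport.2 ⟨hdvd d hd, ?_⟩)
      fun _ hl _ => (selbergTerms_pos_of_mem_selbergSupport hl).le
  have hdR : (d : ℝ) ≤ R := by exact_mod_cast (mem_squarefreeCoprimeTo.1 hd).1.2
  exact pow_le_pow_left₀ (Nat.cast_nonneg d) hdR 2

theorem sum_inv_prime_pair_le {A B k l r : ℕ} (hr : 2 ≤ r) (hrA : r ^ 2 ≤ A) (hAB : A ≤ B)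
    (hk : 0 < k) (hkl : k < l) :
    ∑ m ∈ Ioc A B with (k * m + 1).Prime ∧ (l * m + 1).Prime, (m : ℝ)⁻¹ ≤
      8 * abundancyIndex (pairModulus k l) ^ 2 / Real.log r ^ 2 * ∑ m ∈ Ioc A B, (m : ℝ)⁻¹ +
        (r : ℝ) ^ 8 / (A + 1) := by
  have hR : 1 ≤ r ^ 2 := Nat.one_le_pow _ _ (by lia)
  have hS := selbergSum_pos (primePairSieve A B k l hR)
  have hlog : 0 < Real.log r := Real.log_pos (by exact_mod_cast hr)
  have hlogS : Real.log r ^ 2 ≤ 8 * abundancyIndex (pairModulus k l) ^ 2 *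
      selbergSum (primePairSieve A B k l hR) :=
    (log_sq_le_abundancyIndex_sq_mul (pairModulus_ne_zero hk hkl)).trans
      (by grw [sum_divisorDensity_le_selbergSum hR])
  have hinv : (selbergSum (primePairSieve A B k l hR))⁻¹ ≤
      8 * abundancyIndex (pairModulus k l) ^ 2 / Real.log r ^ 2 := by
    rw [le_div_iff₀ (by positivity), inv_mul_le_iff₀ hS]
    linarith
  have : 0 ≤ ∑ m ∈ Ioc A B, (m : ℝ)⁻¹ := sum_nonneg fun _ _ => by positivity
  calc _ ≤ (∑ m ∈ Ioc A B, (m : ℝ)⁻¹) / selbergSum (primePairSieve A B k l hR) +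
          ((r ^ 2 : ℕ) : ℝ) ^ 4 / (A + 1) :=
        sum_inv_prime_pair_le_div_selbergSum hR hk (hk.trans hkl) hrA hAB
    _ = (selbergSum (primePairSieve A B k l hR))⁻¹ * ∑ m ∈ Ioc A B, (m : ℝ)⁻¹ +
          (r : ℝ) ^ 8 / (A + 1) := by
        push_cast
        ring
    _ ≤ _ := by gcongr

/-! ### Moments of the abundancy index -/

lemma abundancyIndex_mul_le (m n : ℕ) :
    abundancyIndex (m * n) ≤ abundancyIndex m * abundancyIndex n := by
  have hcover : (m * n).divisors ⊆ (m.divisors ×ˢ n.divisors).image fun p => p.1 * p.2 := by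
    rw [Nat.divisors_mul, image_mul_product]
  calc abundancyIndex (m * n)
      ≤ ∑ p ∈ m.divisors ×ˢ n.divisors, ((p.1 * p.2 : ℕ) : ℝ)⁻¹ :=
        sum_le_sum_comp_of_subset_image (fun d : ℕ => (d : ℝ)⁻¹) (fun _ _ => by positivity) hcover
    _ = abundancyIndex m * abundancyIndex n := by
        rw [abundancyIndex, abundancyIndex, sum_mul_sum, ← sum_product']
        push_cast
        simp only [mul_inv]

lemma pow_sum_mul_le_pow_mul_sum_mul_pow {ι : Type*} (s : Finset ι) {p : ℕ} (hp : p ≠ 0)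
    {w f : ι → ℝ} (hw : ∀ i, 0 ≤ w i) (hf : ∀ i, 0 ≤ f i) :
    (∑ i ∈ s, w i * f i) ^ p ≤ (∑ i ∈ s, w i) ^ (p - 1) * ∑ i ∈ s, w i * f i ^ p := by
  have hW : 0 ≤ ∑ i ∈ s, w i := sum_nonneg fun i _ => hw i
  have hWf : 0 ≤ ∑ i ∈ s, w i * f i ^ p :=
    sum_nonneg fun i _ => mul_nonneg (hw i) (pow_nonneg (hf i) p)
  have hexp : (1 - (p : ℝ)⁻¹) * p = (p - 1 : ℕ) := by
    rw [Nat.cast_pred (Nat.pos_of_ne_zero hp)]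
    field_simp
  have hHolder := Real.inner_le_weight_mul_Lp_of_nonneg s
    (Nat.one_le_cast.2 (Nat.one_le_iff_ne_zero.2 hp)) w f hw hf
  simp only [Real.rpow_natCast] at hHolder
  calc (∑ i ∈ s, w i * f i) ^ p
      ≤ ((∑ i ∈ s, w i) ^ (1 - (p : ℝ)⁻¹) * (∑ i ∈ s, w i * f i ^ p) ^ (p : ℝ)⁻¹) ^ p :=
        pow_le_pow_left₀ (sum_nonneg fun i _ => mul_nonneg (hw i) (hf i)) hHolder p
    _ = (∑ i ∈ s, w i) ^ (p - 1) * ∑ i ∈ s, w i * f i ^ p := by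
        rw [mul_pow, ← Real.rpow_mul_natCast hW, hexp, Real.rpow_natCast,
          Real.rpow_inv_natCast_pow hWf hp]

/-- The value `ζ(1 + 1 / p)`, which controls the `p`-th moment of the abundancy index. -/
noncomputable def zetaOneAddInv (p : ℕ) : ℝ := ∑' n : ℕ, (n : ℝ) ^ (-(1 + (p : ℝ)⁻¹))

lemma zetaOneAddInv_nonneg (p : ℕ) : 0 ≤ zetaOneAddInv p := tsum_nonneg fun _ => by positivity

lemma sum_rpow_le_zetaOneAddInv {p : ℕ} (hp : p ≠ 0) (s : Finset ℕ) :
    ∑ d ∈ s, (d : ℝ) ^ (-(1 + (p : ℝ)⁻¹)) ≤ zetaOneAddInv p := by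
  have hsum : Summable fun n : ℕ => (n : ℝ) ^ (-(1 + (p : ℝ)⁻¹)) :=
    Real.summable_nat_rpow.2 (neg_lt_neg (lt_add_of_pos_right 1 (by positivity)))
  exact hsum.sum_le_tsum s fun _ _ => by positivity

lemma abundancyIndex_pow_le {p : ℕ} (hp : p ≠ 0) (n : ℕ) :
    abundancyIndex n ^ p ≤
      zetaOneAddInv p ^ (p - 1) * ∑ d ∈ n.divisors, (d : ℝ) ^ (-(p : ℝ)⁻¹) := by
  have hpos : ∀ d ∈ n.divisors, (0 : ℝ) < d := fun d hd => by
    exact_mod_cast Nat.pos_of_mem_divisors hd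
  have hinv : ∀ d ∈ n.divisors, (d : ℝ)⁻¹ = d ^ (-(1 + (p : ℝ)⁻¹)) * d ^ (p : ℝ)⁻¹ :=
    fun d hd => by
      rw [← Real.rpow_add (hpos d hd), neg_add_rev, neg_add_cancel_comm, Real.rpow_neg_one]
  have hpow : ∀ d ∈ n.divisors,
      (d : ℝ) ^ (-(1 + (p : ℝ)⁻¹)) * (d ^ (p : ℝ)⁻¹) ^ p = d ^ (-(p : ℝ)⁻¹) := fun d hd => by
    rw [Real.rpow_inv_natCast_pow (hpos d hd).le hp, ← Real.rpow_add_one (hpos d hd).ne',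
      neg_add_rev, neg_add_cancel_right]
  calc abundancyIndex n ^ p
      = (∑ d ∈ n.divisors, (d : ℝ) ^ (-(1 + (p : ℝ)⁻¹)) * d ^ (p : ℝ)⁻¹) ^ p := by
        rw [abundancyIndex, sum_congr rfl hinv]
    _ ≤ (∑ d ∈ n.divisors, (d : ℝ) ^ (-(1 + (p : ℝ)⁻¹))) ^ (p - 1) *
          ∑ d ∈ n.divisors, (d : ℝ) ^ (-(1 + (p : ℝ)⁻¹)) * (d ^ (p : ℝ)⁻¹) ^ p :=
        pow_sum_mul_le_pow_mul_sum_mul_pow _ hp (fun _ => by positivity) fun _ => by positivity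
    _ ≤ zetaOneAddInv p ^ (p - 1) * ∑ d ∈ n.divisors, (d : ℝ) ^ (-(p : ℝ)⁻¹) := by
        rw [sum_congr rfl hpow]
        gcongr
        exact sum_rpow_le_zetaOneAddInv hp _

lemma sum_inv_filter_dvd_le {d : ℕ} (hd : d ≠ 0) (N : ℕ) :
    ∑ n ∈ Icc 1 N with d ∣ n, (n : ℝ)⁻¹ ≤ (d : ℝ)⁻¹ * ∑ n ∈ Icc 1 N, (n : ℝ)⁻¹ := by
  have hcover : {n ∈ Icc 1 N | d ∣ n} ⊆ (Icc 1 N).image (d * ·) := fun n hn => by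
    obtain ⟨hn, j, rfl⟩ := mem_filter.1 hn
    obtain ⟨h1, hN⟩ := mem_Icc.1 hn
    exact mem_image_of_mem _ (mem_Icc.2 ⟨Nat.pos_of_mul_pos_left h1,
      (Nat.le_mul_of_pos_left j hd.bot_lt).trans hN⟩)
  calc ∑ n ∈ Icc 1 N with d ∣ n, (n : ℝ)⁻¹ ≤ ∑ j ∈ Icc 1 N, ((d * j : ℕ) : ℝ)⁻¹ :=
        sum_le_sum_comp_of_subset_image (fun n : ℕ => (n : ℝ)⁻¹) (fun _ _ => by positivity) hcover
    _ = (d : ℝ)⁻¹ * ∑ n ∈ Icc 1 N, (n : ℝ)⁻¹ := by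
        push_cast
        simp only [mul_inv, mul_sum]

lemma sum_divisors_div_eq_sum_mul_sum_filter_dvd (f : ℕ → ℝ) (N : ℕ) :
    ∑ n ∈ Icc 1 N, (∑ d ∈ n.divisors, f d) / n =
      ∑ d ∈ Icc 1 N, f d * ∑ n ∈ Icc 1 N with d ∣ n, (n : ℝ)⁻¹ := by
  simp only [div_eq_mul_inv, sum_mul, mul_sum]
  refine sum_comm' fun n d => ?_
  simp only [mem_Icc, Nat.mem_divisors, mem_filter]
  constructor
  · rintro ⟨hn, hd, -⟩
    exact ⟨⟨hn, hd⟩, Nat.pos_of_dvd_of_pos hd hn.1, (Nat.le_of_dvd hn.1 hd).trans hn.2⟩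
  · rintro ⟨⟨hn, hd⟩, -⟩
    exact ⟨hn, hd, (Nat.pos_iff_ne_zero.1 hn.1)⟩

lemma sum_abundancyIndex_pow_div_le {p : ℕ} (hp : p ≠ 0) (N : ℕ) :
    ∑ n ∈ Icc 1 N, abundancyIndex n ^ p / n ≤
      zetaOneAddInv p ^ p * ∑ n ∈ Icc 1 N, (n : ℝ)⁻¹ := by
  set Z := zetaOneAddInv p
  set H := ∑ n ∈ Icc 1 N, (n : ℝ)⁻¹
  have hZ0 : 0 ≤ Z := zetaOneAddInv_nonneg p
  have : 0 ≤ H := sum_nonneg fun _ _ => by positivity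
  have hshift : ∀ d ∈ Icc 1 N,
      (d : ℝ) ^ (-(p : ℝ)⁻¹) * ((d : ℝ)⁻¹ * H) = (d : ℝ) ^ (-(1 + (p : ℝ)⁻¹)) * H := fun d hd => by
    have hd0 : (d : ℝ) ≠ 0 := Nat.cast_ne_zero.2 (Nat.pos_iff_ne_zero.1 (mem_Icc.1 hd).1)
    rw [← mul_assoc, ← div_eq_mul_inv, ← Real.rpow_sub_one hd0, neg_add_rev, sub_eq_add_neg]
  calc ∑ n ∈ Icc 1 N, abundancyIndex n ^ p / n
      ≤ ∑ n ∈ Icc 1 N, Z ^ (p - 1) * ((∑ d ∈ n.divisors, (d : ℝ) ^ (-(p : ℝ)⁻¹)) / n) := by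
        refine sum_le_sum fun n _ => ?_
        rw [← mul_div_assoc]
        gcongr
        exact abundancyIndex_pow_le hp n
    _ = Z ^ (p - 1) * ∑ d ∈ Icc 1 N, (d : ℝ) ^ (-(p : ℝ)⁻¹) *
          ∑ n ∈ Icc 1 N with d ∣ n, (n : ℝ)⁻¹ := by
        rw [← mul_sum, sum_divisors_div_eq_sum_mul_sum_filter_dvd]
    _ ≤ Z ^ (p - 1) * ∑ d ∈ Icc 1 N, (d : ℝ) ^ (-(p : ℝ)⁻¹) * ((d : ℝ)⁻¹ * H) := by
        gcongr with d hd
        exact sum_inv_filter_dvd_le (Nat.pos_iff_ne_zero.1 (mem_Icc.1 hd).1) N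
    _ = Z ^ (p - 1) * ((∑ d ∈ Icc 1 N, (d : ℝ) ^ (-(1 + (p : ℝ)⁻¹))) * H) := by
        rw [sum_congr rfl hshift, sum_mul]
    _ ≤ Z ^ (p - 1) * (Z * H) := by
        gcongr
        exact sum_rpow_le_zetaOneAddInv hp _
    _ = Z ^ p * H := by rw [← mul_assoc, pow_sub_one_mul hp]

lemma abundancyIndex_pairModulus_sq_le (k l : ℕ) :
    abundancyIndex (pairModulus k l) ^ 2 ≤
      2 * (abundancyIndex k ^ 4 * abundancyIndex l ^ 4 + abundancyIndex (l - k) ^ 4) := by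
  set u := abundancyIndex k * abundancyIndex l with hu
  set v := abundancyIndex (l - k)
  have htwo : abundancyIndex 2 = 3 / 2 := by
    rw [abundancyIndex, Nat.prime_two.divisors, sum_pair (by norm_num)]
    norm_num
  have hv0 : 0 ≤ v := abundancyIndex_nonneg _
  have hle : abundancyIndex (pairModulus k l) ≤ 3 / 2 * (u * v) := by
    calc _ ≤ abundancyIndex 2 * abundancyIndex (k * l * (l - k)) := abundancyIndex_mul_le _ _
      _ ≤ 3 / 2 * (abundancyIndex (k * l) * v) := by
          rw [htwo]
          gcongr
          exact abundancyIndex_mul_le _ _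
      _ ≤ 3 / 2 * (u * v) := by
          gcongr
          exact abundancyIndex_mul_le k l
  calc abundancyIndex (pairModulus k l) ^ 2 ≤ (3 / 2 * (u * v)) ^ 2 :=
        pow_le_pow_left₀ (abundancyIndex_nonneg _) hle 2
    -- AM-GM separates the factor of `k * l` from that of `l - k`.
    _ = 9 / 8 * (2 * u ^ 2 * v ^ 2) := by ring
    _ ≤ 9 / 8 * ((u ^ 2) ^ 2 + (v ^ 2) ^ 2) := by
        gcongr
        exact two_mul_le_add_sq _ _
    _ ≤ 2 * ((u ^ 2) ^ 2 + (v ^ 2) ^ 2) :=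
        mul_le_mul_of_nonneg_right (by norm_num) (by positivity)
    _ = 2 * (abundancyIndex k ^ 4 * abundancyIndex l ^ 4 + v ^ 4) := by
        rw [hu]
        ring

lemma sum_Ioc_comp_sub_div_le {g : ℕ → ℝ} (hg : ∀ n, 0 ≤ g n) (k N : ℕ) :
    ∑ l ∈ Ioc k N, g (l - k) / l ≤ ∑ h ∈ Icc 1 N, g h / h := by
  have hcover : Ioc k N ⊆ (Icc 1 N).image (k + ·) := fun l hl => by
    obtain ⟨hkl, hlN⟩ := mem_Ioc.1 hl
    exact mem_image.2 ⟨l - k, mem_Icc.2 (by lia), by lia⟩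
  calc ∑ l ∈ Ioc k N, g (l - k) / l ≤ ∑ h ∈ Icc 1 N, g (k + h - k) / (k + h : ℕ) :=
        sum_le_sum_comp_of_subset_image (fun l : ℕ => g (l - k) / l)
          (fun _ _ => div_nonneg (hg _) (Nat.cast_nonneg _)) hcover
    _ ≤ ∑ h ∈ Icc 1 N, g h / h := by
        refine sum_le_sum fun h hh => ?_
        have hh0 : (0 : ℝ) < h := by exact_mod_cast (mem_Icc.1 hh).1
        rw [Nat.add_sub_cancel_left]
        exact div_le_div_of_nonneg_left (hg h) hh0 (by push_cast; linarith [k.cast_nonneg (α := ℝ)])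

theorem sum_abundancyIndex_pairModulus_sq_le (N : ℕ) :
    ∑ k ∈ Icc 1 N, ∑ l ∈ Ioc k N, abundancyIndex (pairModulus k l) ^ 2 / (k * l) ≤
      2 * (zetaOneAddInv 4 ^ 8 + zetaOneAddInv 4 ^ 4) * (∑ n ∈ Icc 1 N, (n : ℝ)⁻¹) ^ 2 := by
  set H := ∑ n ∈ Icc 1 N, (n : ℝ)⁻¹
  set S := ∑ n ∈ Icc 1 N, abundancyIndex n ^ 4 / n
  have : 0 ≤ H := sum_nonneg fun _ _ => by positivity
  have : 0 ≤ S := sum_nonneg fun _ _ => by positivity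
  have hSH : S ≤ zetaOneAddInv 4 ^ 4 * H := sum_abundancyIndex_pow_div_le four_ne_zero N
  have hinner : ∀ k ∈ Icc 1 N, ∑ l ∈ Ioc k N, abundancyIndex (pairModulus k l) ^ 2 / (k * l) ≤
      2 * (abundancyIndex k ^ 4 / k * S + (k : ℝ)⁻¹ * S) := fun k hk => by
    have hproduct : ∑ l ∈ Ioc k N, abundancyIndex l ^ 4 / l ≤ S :=
      sum_le_sum_of_subset_of_nonneg (Ioc_subset_Icc_self.trans (Icc_subset_Icc_left
        (mem_Icc.1 hk).1)) fun _ _ _ => by positivity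
    have hdiff : ∑ l ∈ Ioc k N, abundancyIndex (l - k) ^ 4 / l ≤ S :=
      sum_Ioc_comp_sub_div_le (g := fun n => abundancyIndex n ^ 4) (fun _ => by positivity) k N
    calc _ ≤ ∑ l ∈ Ioc k N, 2 * (abundancyIndex k ^ 4 / k * (abundancyIndex l ^ 4 / l) +
            (k : ℝ)⁻¹ * (abundancyIndex (l - k) ^ 4 / l)) := sum_le_sum fun l _ => by
          grw [abundancyIndex_pairModulus_sq_le]
          exact le_of_eq (by ring)
      _ = 2 * (abundancyIndex k ^ 4 / k * ∑ l ∈ Ioc k N, abundancyIndex l ^ 4 / l +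
            (k : ℝ)⁻¹ * ∑ l ∈ Ioc k N, abundancyIndex (l - k) ^ 4 / l) := by
          rw [← mul_sum, sum_add_distrib, ← mul_sum, ← mul_sum]
      _ ≤ _ := by gcongr
  calc _ ≤ ∑ k ∈ Icc 1 N, 2 * (abundancyIndex k ^ 4 / k * S + (k : ℝ)⁻¹ * S) := sum_le_sum hinner
    _ = 2 * (S * S + H * S) := by rw [← mul_sum, sum_add_distrib, ← sum_mul, ← sum_mul]
    _ ≤ 2 * ((zetaOneAddInv 4 ^ 4 * H) * (zetaOneAddInv 4 ^ 4 * H) +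
          H * (zetaOneAddInv 4 ^ 4 * H)) := by gcongr
    _ = _ := by ring

/-! ### The second moment -/

lemma sum_sum_Icc_eq_sum_diag_add_two_mul_of_symm {ι R : Type*} [LinearOrder ι]
    [LocallyFiniteOrder ι] [NonAssocSemiring R] {f : ι → ι → R} (hf : ∀ k l, f k l = f l k)
    (a b : ι) :
    ∑ k ∈ Icc a b, ∑ l ∈ Icc a b, f k l =
      ∑ k ∈ Icc a b, f k k + 2 * ∑ k ∈ Icc a b, ∑ l ∈ Ioc k b, f k l := by
  have hsplit : ∀ k ∈ Icc a b,
      ∑ l ∈ Icc a b, f k l = ∑ l ∈ Ico a k, f k l + (f k k + ∑ l ∈ Ioc k b, f k l) :=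
    fun k hk => by
      obtain ⟨hak, hkb⟩ := mem_Icc.1 hk
      have hdisj : Disjoint (Ico a k) (Icc k b) :=
        disjoint_left.2 fun l hl hl' => (mem_Ico.1 hl).2.not_ge (mem_Icc.1 hl').1
      have hunion : Icc a b = Ico a k ∪ Icc k b := by
        ext l
        simp only [mem_union, mem_Icc, mem_Ico]
        grind
      rw [hunion, sum_union hdisj, ← Ioc_insert_left hkb, sum_insert left_notMem_Ioc]
  have hsymm : ∑ k ∈ Icc a b, ∑ l ∈ Ico a k, f k l = ∑ k ∈ Icc a b, ∑ l ∈ Ioc k b, f k l := by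
    rw [sum_comm' (t' := Icc a b) (s' := fun l => Ioc l b)]
    · exact sum_congr rfl fun l _ => sum_congr rfl fun k _ => hf k l
    · intro k l
      simp only [mem_Icc, mem_Ico, mem_Ioc]
      grind
  rw [sum_congr rfl hsplit, sum_add_distrib, sum_add_distrib, hsymm, two_mul]
  abel

lemma sum_mul_sq_sum_filter {ι κ R : Type*} [CommSemiring R] (P : ι → κ → Prop)
    [∀ k m, Decidable (P k m)] (s : Finset ι) (t : Finset κ) (f : ι → R) (w : κ → R) :
    ∑ m ∈ t, w m * (∑ k ∈ s with P k m, f k) ^ 2 =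
      ∑ k ∈ s, ∑ l ∈ s, f k * f l * ∑ m ∈ t with P k m ∧ P l m, w m := by
  have hterm : ∀ m ∈ t, w m * (∑ k ∈ s with P k m, f k) ^ 2 =
      ∑ k ∈ s, ∑ l ∈ s, f k * f l * if P k m ∧ P l m then w m else 0 := fun m _ => by
    rw [sq, sum_filter, sum_mul_sum, mul_sum]
    refine sum_congr rfl fun k _ => ?_
    rw [mul_sum]
    refine sum_congr rfl fun l _ => ?_
    split_ifs <;> grind
  rw [sum_congr rfl hterm, sum_comm]
  refine sum_congr rfl fun k _ => ?_
  rw [sum_comm]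
  simp only [← mul_sum, ← sum_filter]

lemma sum_sum_Ioc_inv_mul_inv_le_sq (N : ℕ) :
    ∑ k ∈ Icc 1 N, ∑ l ∈ Ioc k N, (k : ℝ)⁻¹ * (l : ℝ)⁻¹ ≤ (∑ k ∈ Icc 1 N, (k : ℝ)⁻¹) ^ 2 := by
  rw [sq, sum_mul_sum]
  exact sum_le_sum fun k hk => sum_le_sum_of_subset_of_nonneg
    (Ioc_subset_Icc_self.trans (Icc_subset_Icc_left (mem_Icc.1 hk).1)) fun _ _ _ => by positivity

/-- The sum of `1 / k` over the `k ≤ N` for which `k * m + 1` is prime. Divided by `m`, it bounds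
the integral of `π(t; m, 1) / (t - 1) ^ 2`. -/
noncomputable def sumInvPrimeMultipliers (N m : ℕ) : ℝ :=
  ∑ k ∈ Icc 1 N with (k * m + 1).Prime, (k : ℝ)⁻¹

section SecondMoment

variable {A B r : ℕ}

lemma sum_diag_prime_pair_le (A B N : ℕ) :
    ∑ k ∈ Icc 1 N, (k : ℝ)⁻¹ * (k : ℝ)⁻¹ *
        ∑ m ∈ Ioc A B with (k * m + 1).Prime ∧ (k * m + 1).Prime, (m : ℝ)⁻¹ ≤
      2 * ∑ m ∈ Ioc A B, (m : ℝ)⁻¹ := by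
  calc _ ≤ ∑ k ∈ Icc 1 N, ((k : ℝ) ^ 2)⁻¹ * ∑ m ∈ Ioc A B, (m : ℝ)⁻¹ := sum_le_sum fun k _ => by
        rw [← sq, ← inv_pow]
        gcongr
        exact filter_subset _ _
    _ ≤ 2 * ∑ m ∈ Ioc A B, (m : ℝ)⁻¹ := by
        rw [← sum_mul]
        gcongr
        exact sum_Icc_inv_sq_le_two N

lemma sum_offDiag_prime_pair_le (hr : 2 ≤ r) (hrA : r ^ 2 ≤ A) (hAB : A ≤ B) (N : ℕ) :
    ∑ k ∈ Icc 1 N, ∑ l ∈ Ioc k N, (k : ℝ)⁻¹ * (l : ℝ)⁻¹ *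
        ∑ m ∈ Ioc A B with (k * m + 1).Prime ∧ (l * m + 1).Prime, (m : ℝ)⁻¹ ≤
      16 * (zetaOneAddInv 4 ^ 8 + zetaOneAddInv 4 ^ 4) *
          ((∑ k ∈ Icc 1 N, (k : ℝ)⁻¹) / Real.log r) ^ 2 * ∑ m ∈ Ioc A B, (m : ℝ)⁻¹ +
        (∑ k ∈ Icc 1 N, (k : ℝ)⁻¹) ^ 2 * ((r : ℝ) ^ 8 / (A + 1)) := by
  set X := ∑ m ∈ Ioc A B, (m : ℝ)⁻¹
  set H := ∑ k ∈ Icc 1 N, (k : ℝ)⁻¹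
  set E := (r : ℝ) ^ 8 / (A + 1)
  have : 0 ≤ X := sum_nonneg fun _ _ => by positivity
  calc _ ≤ ∑ k ∈ Icc 1 N, ∑ l ∈ Ioc k N, (k : ℝ)⁻¹ * (l : ℝ)⁻¹ *
          (8 * abundancyIndex (pairModulus k l) ^ 2 / Real.log r ^ 2 * X + E) := by
        gcongr with k hk l hl
        exact sum_inv_prime_pair_le hr hrA hAB (mem_Icc.1 hk).1 (mem_Ioc.1 hl).1
    _ = ∑ k ∈ Icc 1 N, ∑ l ∈ Ioc k N,
          (8 / Real.log r ^ 2 * X * (abundancyIndex (pairModulus k l) ^ 2 / (k * l)) +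
            (k : ℝ)⁻¹ * (l : ℝ)⁻¹ * E) :=
        sum_congr rfl fun _ _ => sum_congr rfl fun _ _ => by ring
    _ = 8 / Real.log r ^ 2 * X * (∑ k ∈ Icc 1 N, ∑ l ∈ Ioc k N,
            abundancyIndex (pairModulus k l) ^ 2 / (k * l)) +
          (∑ k ∈ Icc 1 N, ∑ l ∈ Ioc k N, (k : ℝ)⁻¹ * (l : ℝ)⁻¹) * E := by
        simp only [sum_add_distrib, mul_sum, sum_mul]
    _ ≤ 8 / Real.log r ^ 2 * X * (2 * (zetaOneAddInv 4 ^ 8 + zetaOneAddInv 4 ^ 4) * H ^ 2) +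
          H ^ 2 * E := by
        gcongr
        · exact sum_abundancyIndex_pairModulus_sq_le N
        · exact sum_sum_Ioc_inv_mul_inv_le_sq N
    _ = _ := by ring

theorem sum_inv_mul_sumInvPrimeMultipliers_sq_le (hr : 2 ≤ r) (hrA : r ^ 2 ≤ A) (hAB : A ≤ B)
    (N : ℕ) :
    ∑ m ∈ Ioc A B, (m : ℝ)⁻¹ * sumInvPrimeMultipliers N m ^ 2 ≤
      (2 + 32 * (zetaOneAddInv 4 ^ 8 + zetaOneAddInv 4 ^ 4) *
          ((∑ k ∈ Icc 1 N, (k : ℝ)⁻¹) / Real.log r) ^ 2) * ∑ m ∈ Ioc A B, (m : ℝ)⁻¹ +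
        2 * (∑ k ∈ Icc 1 N, (k : ℝ)⁻¹) ^ 2 * ((r : ℝ) ^ 8 / (A + 1)) := by
  simp only [sumInvPrimeMultipliers]
  rw [sum_mul_sq_sum_filter fun k m : ℕ => (k * m + 1).Prime,
    sum_sum_Icc_eq_sum_diag_add_two_mul_of_symm fun k l => by
      simp only [mul_comm (k : ℝ)⁻¹, and_comm]]
  linarith [sum_diag_prime_pair_le A B N, sum_offDiag_prime_pair_le hr hrA hAB N]

end SecondMoment

/-! ### Reduction of the integral -/

lemma integral_indicator_Ici {E : Type*} [NormedAddCommGroup E] [NormedSpace ℝ E] {a p x : ℝ}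
    (f : ℝ → E) (hap : a ≤ p) (hpx : p ≤ x) :
    ∫ t in a..x, (Set.Ici p).indicator f t = ∫ t in p..x, f t := by
  have hset : (Set.Ioc a x ∩ Set.Ici p : Set ℝ) =ᵐ[MeasureTheory.volume] Set.Ioc p x := by
    rw [← max_eq_right hap, ← Set.Ioc_inter_Ioi, max_eq_right hap]
    exact (Filter.EventuallyEq.refl _ _).inter MeasureTheory.Ioi_ae_eq_Ici.symm
  rw [intervalIntegral.integral_of_le (hap.trans hpx), intervalIntegral.integral_of_le hpx,
    MeasureTheory.setIntegral_indicator measurableSet_Ici,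
    MeasureTheory.setIntegral_congr_set hset]

lemma integral_inv_sub_one_sq {a b : ℝ} (ha : 1 < a) (hab : a ≤ b) :
    ∫ t in a..b, ((t - 1) ^ 2)⁻¹ = (a - 1)⁻¹ - (b - 1)⁻¹ := by
  have hzero : (0 : ℝ) ∉ Set.uIcc (a - 1) (b - 1) := by
    rw [Set.uIcc_of_le (by linarith)]
    exact fun h => by linarith [h.1]
  have hneg : ((-2 : ℤ) : ℝ) + 1 = -1 := by norm_num
  have h := integral_zpow (n := -2) (Or.inr ⟨by norm_num, hzero⟩)
  rw [hneg, div_neg, div_one, neg_sub] at h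
  rw [intervalIntegral.integral_comp_sub_right (fun u : ℝ => (u ^ 2)⁻¹) 1]
  simpa [zpow_neg] using h

lemma intervalIntegrable_inv_sub_one_sq {a b : ℝ} (ha : 1 < a) (hab : a ≤ b) :
    IntervalIntegrable (fun t : ℝ => ((t - 1) ^ 2)⁻¹) MeasureTheory.volume a b := by
  refine ContinuousOn.intervalIntegrable (ContinuousOn.inv₀ (by fun_prop) fun t ht => ?_)
  rw [Set.uIcc_of_le hab] at ht
  exact pow_ne_zero 2 (by linarith [ht.1])

lemma primeCountingAP_mul_eq_sum_indicator {t x : ℝ} (ht : 0 ≤ t) (htx : t ≤ x) (m a : ℕ)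
    (f : ℝ → ℝ) :
    primeCountingAP t m a * f t =
      ∑ p ∈ Icc 1 ⌊x⌋₊ with p.Prime ∧ p ≡ a [MOD m], (Set.Ici (p : ℝ)).indicator f t := by
  have hset : {p ∈ Icc 1 ⌊t⌋₊ | p.Prime ∧ p ≡ a [MOD m]} =
      {p ∈ {p ∈ Icc 1 ⌊x⌋₊ | p.Prime ∧ p ≡ a [MOD m]} | ((p : ℕ) : ℝ) ≤ t} := by
    ext p
    have := Nat.floor_mono htx
    simp only [mem_filter, mem_Icc, ← Nat.le_floor_iff ht]
    grind
  simp only [primeCountingAP, hset, Set.indicator_apply, Set.mem_Ici, ← sum_filter, sum_const,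
    nsmul_eq_mul]

lemma integral_primeCountingAP_div_le_sum_inv {x : ℝ} (hx : 2 ≤ x) (m a : ℕ) :
    ∫ t in (2 : ℝ)..x, (primeCountingAP t m a : ℝ) / (t - 1) ^ 2 ≤
      ∑ p ∈ Icc 1 ⌊x⌋₊ with p.Prime ∧ p ≡ a [MOD m], ((p : ℝ) - 1)⁻¹ := by
  have hint : ∀ p : ℝ, IntervalIntegrable
      ((Set.Ici p).indicator fun t : ℝ => ((t - 1) ^ 2)⁻¹) MeasureTheory.volume 2 x := fun p => by
    have h := intervalIntegrable_inv_sub_one_sq one_lt_two hx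
    rw [intervalIntegrable_iff_integrableOn_Ioc_of_le hx] at h ⊢
    exact h.indicator measurableSet_Ici
  calc _ = ∫ t in (2 : ℝ)..x, ∑ p ∈ Icc 1 ⌊x⌋₊ with p.Prime ∧ p ≡ a [MOD m],
          (Set.Ici (p : ℝ)).indicator (fun t : ℝ => ((t - 1) ^ 2)⁻¹) t := by
        refine intervalIntegral.integral_congr fun t ht => ?_
        rw [Set.uIcc_of_le hx] at ht
        exact primeCountingAP_mul_eq_sum_indicator (zero_le_two.trans ht.1) ht.2 m a
          fun t => ((t - 1) ^ 2)⁻¹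
    _ = ∑ p ∈ Icc 1 ⌊x⌋₊ with p.Prime ∧ p ≡ a [MOD m],
          ∫ t in (2 : ℝ)..x, (Set.Ici (p : ℝ)).indicator (fun t : ℝ => ((t - 1) ^ 2)⁻¹) t :=
        intervalIntegral.integral_finsetSum fun p _ => hint p
    _ ≤ _ := sum_le_sum fun p hp => by
        obtain ⟨hpx, hp, -⟩ := mem_filter.1 hp
        have h2p : (2 : ℝ) ≤ p := by exact_mod_cast hp.two_le
        have hpx : (p : ℝ) ≤ x := (Nat.le_floor_iff (by linarith)).1 (mem_Icc.1 hpx).2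
        rw [integral_indicator_Ici _ h2p hpx, integral_inv_sub_one_sq (by linarith) hpx]
        exact sub_le_self _ (inv_nonneg.2 (by linarith))

lemma sum_inv_sub_one_primes_modEq_one_le {m : ℕ} (hm : 0 < m) (N : ℕ) :
    ∑ p ∈ Icc 1 N with p.Prime ∧ p ≡ 1 [MOD m], ((p : ℝ) - 1)⁻¹ ≤
      (m : ℝ)⁻¹ * sumInvPrimeMultipliers N m := by
  have hcover : {p ∈ Icc 1 N | p.Prime ∧ p ≡ 1 [MOD m]} ⊆
      {k ∈ Icc 1 N | (k * m + 1).Prime}.image fun k => k * m + 1 := fun p hp => by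
    obtain ⟨hpN, hp, hpm⟩ := mem_filter.1 hp
    obtain ⟨k, hk⟩ := (Nat.modEq_iff_dvd' hp.one_le).1 hpm.symm
    have hpk : k * m + 1 = p := by
      have := hp.one_le
      rw [mul_comm]
      lia
    have hk0 : 0 < k := Nat.pos_of_ne_zero fun h => hp.ne_one (by simp [← hpk, h])
    have hkN : k ≤ N := by
      have := Nat.le_mul_of_pos_right k hm
      have := (mem_Icc.1 hpN).2
      lia
    exact mem_image.2 ⟨k, mem_filter.2 ⟨mem_Icc.2 ⟨hk0, hkN⟩, hpk ▸ hp⟩, hpk⟩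
  have hsub : ∀ k : ℕ, (((k * m + 1 : ℕ) : ℝ) - 1)⁻¹ = (m : ℝ)⁻¹ * (k : ℝ)⁻¹ := fun k => by
    push_cast
    rw [add_sub_cancel_right, mul_inv_rev]
  calc _ ≤ ∑ k ∈ Icc 1 N with (k * m + 1).Prime, (((k * m + 1 : ℕ) : ℝ) - 1)⁻¹ :=
        sum_le_sum_comp_of_subset_image (fun p : ℕ => ((p : ℝ) - 1)⁻¹)
          (fun k _ => by rw [hsub]; positivity) hcover
    _ = (m : ℝ)⁻¹ * sumInvPrimeMultipliers N m := by
        rw [sumInvPrimeMultipliers, mul_sum]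
        exact sum_congr rfl fun k _ => hsub k

lemma totient_mul_integral_primeCountingAP_sq_le {x : ℝ} {m : ℕ} (hx : 2 ≤ x) (hm : 0 < m) :
    (Nat.totient m : ℝ) * (∫ t in (2 : ℝ)..x, (primeCountingAP t m 1 : ℝ) / (t - 1) ^ 2) ^ 2 ≤
      (m : ℝ)⁻¹ * sumInvPrimeMultipliers ⌊x⌋₊ m ^ 2 := by
  have hnonneg : 0 ≤ ∫ t in (2 : ℝ)..x, (primeCountingAP t m 1 : ℝ) / (t - 1) ^ 2 :=
    intervalIntegral.integral_nonneg hx fun _ _ => by positivity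
  calc _ ≤ (m : ℝ) * ((m : ℝ)⁻¹ * sumInvPrimeMultipliers ⌊x⌋₊ m) ^ 2 := by
        gcongr
        · exact Nat.totient_le m
        · exact (integral_primeCountingAP_div_le_sum_inv hx m 1).trans
            (sum_inv_sub_one_primes_modEq_one_le hm _)
    _ = (m : ℝ)⁻¹ * sumInvPrimeMultipliers ⌊x⌋₊ m ^ 2 := by field_simp

/-! ### Choice of parameters -/

lemma sum_inv_Ioc_le_log_sub_log {A B : ℕ} (hA : 0 < A) (hAB : A ≤ B) :
    ∑ m ∈ Ioc A B, (m : ℝ)⁻¹ ≤ Real.log B - Real.log A := by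
  induction B, hAB using Nat.le_induction with
  | base => simp
  | succ B hAB ih =>
    have hB : (0 : ℝ) < B := by exact_mod_cast hA.trans_le hAB
    have hstep : ((B + 1 : ℕ) : ℝ)⁻¹ ≤ Real.log (B + 1 : ℕ) - Real.log B := by
      have h := Real.one_sub_inv_le_log_of_pos (x := ((B + 1 : ℕ) : ℝ) / B) (by positivity)
      rw [Real.log_div (by positivity) hB.ne'] at h
      convert h using 1
      push_cast
      field_simp
      ring
    rw [sum_Ioc_succ_top hAB]
    linarith

lemma filter_lt_Icc_one_eq_Ioc_floor {y : ℝ} (hy : 0 ≤ y) (N : ℕ) :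
    {m ∈ Icc 1 N | y < ((m : ℕ) : ℝ)} = Ioc ⌊y⌋₊ N := by
  ext m
  simp only [mem_filter, mem_Icc, mem_Ioc, Nat.floor_lt hy]
  exact ⟨fun h => ⟨h.2, h.1.2⟩,
    fun h => ⟨⟨Nat.one_le_iff_ne_zero.2 fun hm => by simp [hm] at h; linarith, h.2⟩, h.1⟩⟩

lemma rpow_le_floor_rpow_two_mul {x a : ℝ} (hx : 0 < x) (h : 2 ≤ x ^ a) :
    x ^ a ≤ ⌊x ^ (2 * a)⌋₊ := by
  have hsq : x ^ (2 * a) = x ^ a * x ^ a := by rw [two_mul, Real.rpow_add hx]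
  have := Nat.lt_floor_add_one (x ^ (2 * a))
  nlinarith

lemma log_rpow_sub_log_two_le_log_floor {x a : ℝ} (hx : 1 ≤ x) (ha : 0 ≤ a) :
    a * Real.log x - Real.log 2 ≤ Real.log ⌊x ^ a⌋₊ := by
  have hpow : 1 ≤ x ^ a := Real.one_le_rpow hx ha
  rw [← Real.log_rpow (by linarith), ← Real.log_div (by linarith) two_ne_zero]
  exact Real.log_le_log (by linarith) (Nat.div_two_lt_floor hpow).le

lemma sum_inv_Ioc_floor_rpow_le {x ε : ℝ} (hx : 1 ≤ x) (hε : 0 ≤ ε) (hε' : ε ≤ 1) :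
    ∑ m ∈ Ioc ⌊x ^ (1 - ε)⌋₊ ⌊x⌋₊, (m : ℝ)⁻¹ ≤ ε * Real.log x + Real.log 2 := by
  have hA : 0 < ⌊x ^ (1 - ε)⌋₊ := Nat.floor_pos.2 (Real.one_le_rpow hx (by linarith))
  have hAB : ⌊x ^ (1 - ε)⌋₊ ≤ ⌊x⌋₊ :=
    Nat.floor_mono (Real.rpow_le_self_of_one_le hx (by linarith))
  have hB : Real.log ⌊x⌋₊ ≤ Real.log x :=
    Real.log_le_log (by exact_mod_cast hA.trans_le hAB) (Nat.floor_le (by linarith))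
  linarith [sum_inv_Ioc_le_log_sub_log hA hAB,
    log_rpow_sub_log_two_le_log_floor hx (sub_nonneg.2 hε')]

lemma sum_inv_Icc_floor_le_two_mul_log {x : ℝ} (hx : 1 ≤ Real.log x) (hx1 : 1 ≤ x) :
    ∑ k ∈ Icc 1 ⌊x⌋₊, (k : ℝ)⁻¹ ≤ 2 * Real.log x := by
  have h := harmonic_floor_le_one_add_log x hx1
  rw [harmonic_eq_sum_Icc] at h
  push_cast at h
  linarith

/-- The parameter `r` of the sieve, a small power of `x`: pairs of linear forms are sifted by the
moduli up to `r ^ 2`. -/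
noncomputable def sieveParameter (x : ℝ) : ℕ := ⌊x ^ (1 / 32 : ℝ)⌋₊

section Parameters

variable {x ε : ℝ}

lemma two_le_rpow_one_div_sixty_four (hx : 2 ^ 64 ≤ x) : 2 ≤ x ^ (1 / 64 : ℝ) := by
  rw [one_div, Real.le_rpow_inv_iff_of_pos zero_le_two (by linarith) (by norm_num)]
  exact_mod_cast hx

lemma rpow_le_sieveParameter (hx : 2 ^ 64 ≤ x) : x ^ (1 / 64 : ℝ) ≤ sieveParameter x := by
  have h := rpow_le_floor_rpow_two_mul (by linarith) (two_le_rpow_one_div_sixty_four hx)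
  rwa [show (2 : ℝ) * (1 / 64) = 1 / 32 by norm_num] at h

lemma two_le_sieveParameter (hx : 2 ^ 64 ≤ x) : 2 ≤ sieveParameter x := by
  exact_mod_cast (two_le_rpow_one_div_sixty_four hx).trans (rpow_le_sieveParameter hx)

lemma log_le_mul_log_sieveParameter (hx : 2 ^ 64 ≤ x) :
    Real.log x ≤ 64 * Real.log (sieveParameter x) := by
  have h := Real.log_le_log (by positivity) (rpow_le_sieveParameter hx)
  rw [Real.log_rpow (by linarith)] at h
  linarith

lemma sieveParameter_pow_le (hx : 0 ≤ x) (n : ℕ) :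
    (sieveParameter x : ℝ) ^ n ≤ x ^ (n / 32 : ℝ) := by
  calc (sieveParameter x : ℝ) ^ n ≤ (x ^ (1 / 32 : ℝ)) ^ n := by
        gcongr
        exact Nat.floor_le (by positivity)
    _ = x ^ (n / 32 : ℝ) := by rw [← Real.rpow_mul_natCast hx, one_div_mul_eq_div]

lemma sieveParameter_sq_le_floor (hx : 1 ≤ x) (hε : ε ≤ 1 / 2) :
    sieveParameter x ^ 2 ≤ ⌊x ^ (1 - ε)⌋₊ := by
  refine Nat.le_floor ?_
  push_cast
  exact (sieveParameter_pow_le (by linarith) 2).trans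
    (Real.rpow_le_rpow_of_exponent_le hx (by norm_num; linarith))

lemma one_le_log_of_two_pow_le (hx : 2 ^ 64 ≤ x) : 1 ≤ Real.log x :=
  (Real.le_log_iff_exp_le (by linarith)).2 (by linarith [Real.exp_one_lt_three])

lemma sum_inv_Icc_div_log_sieveParameter_le (hx : 2 ^ 64 ≤ x) :
    (∑ k ∈ Icc 1 ⌊x⌋₊, (k : ℝ)⁻¹) / Real.log (sieveParameter x) ≤ 128 := by
  have hlog := log_le_mul_log_sieveParameter hx
  have hlog1 := one_le_log_of_two_pow_le hx
  rw [div_le_iff₀ (by linarith)]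
  linarith [sum_inv_Icc_floor_le_two_mul_log hlog1 (by linarith)]

-- The exponents `2 / 8`, `8 / 32` and `1 / 2` of the three factors cancel.
lemma sum_inv_Icc_sq_mul_sieveParameter_pow_div_le (hx : 2 ^ 64 ≤ x) (hε : ε ≤ 1 / 2) :
    (∑ k ∈ Icc 1 ⌊x⌋₊, (k : ℝ)⁻¹) ^ 2 * ((sieveParameter x : ℝ) ^ 8 / (⌊x ^ (1 - ε)⌋₊ + 1)) ≤
      256 := by
  have hx0 : 0 < x := by linarith
  have hH : ∑ k ∈ Icc 1 ⌊x⌋₊, (k : ℝ)⁻¹ ≤ 16 * x ^ (1 / 8 : ℝ) := by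
    have h := Real.log_le_rpow_div hx0.le (show (0 : ℝ) < 1 / 8 by norm_num)
    linarith [sum_inv_Icc_floor_le_two_mul_log (one_le_log_of_two_pow_le hx) (by linarith)]
  have hr : (sieveParameter x : ℝ) ^ 8 ≤ x ^ (1 / 4 : ℝ) := by
    convert sieveParameter_pow_le hx0.le 8 using 2
    norm_num
  have hA : x ^ (1 / 2 : ℝ) ≤ ⌊x ^ (1 - ε)⌋₊ + 1 :=
    (Real.rpow_le_rpow_of_exponent_le (by linarith) (by linarith)).trans
      (Nat.lt_floor_add_one _).le
  calc _ ≤ (16 * x ^ (1 / 8 : ℝ)) ^ 2 * (x ^ (1 / 4 : ℝ) / x ^ (1 / 2 : ℝ)) := by gcongr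
    _ = 256 * (x ^ (1 / 8 : ℝ) * x ^ (1 / 8 : ℝ) * x ^ (1 / 4 : ℝ) / x ^ (1 / 2 : ℝ)) := by ring
    _ = 256 := by
        rw [← Real.rpow_add hx0, ← Real.rpow_add hx0, ← Real.rpow_sub hx0]
        norm_num

theorem sum_Ioc_floor_rpow_inv_mul_sumInvPrimeMultipliers_sq_le (hx : 2 ^ 64 ≤ x) (hε : 0 ≤ ε)
    (hε' : ε ≤ 1 / 2) :
    ∑ m ∈ Ioc ⌊x ^ (1 - ε)⌋₊ ⌊x⌋₊, (m : ℝ)⁻¹ * sumInvPrimeMultipliers ⌊x⌋₊ m ^ 2 ≤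
      (2 + 32 * (zetaOneAddInv 4 ^ 8 + zetaOneAddInv 4 ^ 4) * 128 ^ 2) *
        (ε * Real.log x + Real.log 2) + 512 := by
  have hx1 : 1 ≤ x := by linarith
  have hr := two_le_sieveParameter hx
  have hAB : ⌊x ^ (1 - ε)⌋₊ ≤ ⌊x⌋₊ :=
    Nat.floor_mono (Real.rpow_le_self_of_one_le hx1 (by linarith))
  have hratio := sum_inv_Icc_div_log_sieveParameter_le hx
  have hX := sum_inv_Ioc_floor_rpow_le hx1 hε (by linarith)
  have hmain := sum_inv_mul_sumInvPrimeMultipliers_sq_le hr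
    (sieveParameter_sq_le_floor hx1 hε') hAB ⌊x⌋₊
  have herror := sum_inv_Icc_sq_mul_sieveParameter_pow_div_le hx hε'
  have := zetaOneAddInv_nonneg 4
  have := Real.log_natCast_nonneg (sieveParameter x)
  refine hmain.trans (add_le_add ?_ (by linarith))
  gcongr

end Parameters

theorem proposition1 :
    ∃ C : ℝ, 0 < C ∧ ∃ ε₀ : ℝ, 0 < ε₀ ∧
      ∀ ε : ℝ, 0 < ε → ε < ε₀ →
        ∃ x₀ : ℝ, ∀ x : ℝ, x₀ ≤ x →
          ∑ m ∈ (Finset.Icc 1 ⌊x⌋₊).filter (fun m : ℕ => x ^ (1 - ε) < (m : ℝ)),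
              (Nat.totient m : ℝ) *
                (∫ t in (2 : ℝ)..x, (primeCountingAP t m 1 : ℝ) / (t - 1) ^ 2) ^ 2
            ≤ C * (ε * Real.log x) := by
  set K := 2 + 32 * (zetaOneAddInv 4 ^ 8 + zetaOneAddInv 4 ^ 4) * 128 ^ 2
  have : 0 < K := by
    have := zetaOneAddInv_nonneg 4
    positivity
  refine ⟨2 * K + 512, by positivity, 1 / 2, by norm_num, fun ε hε hε' =>
    ⟨max (Real.exp (1 / ε)) (2 ^ 64), fun x hx => ?_⟩⟩
  obtain ⟨hxexp, hx⟩ := max_le_iff.1 hx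
  have hlog : 1 ≤ ε * Real.log x :=
    (div_le_iff₀' hε).1 ((Real.le_log_iff_exp_le (by linarith)).2 hxexp)
  rw [filter_lt_Icc_one_eq_Ioc_floor (by positivity)]
  calc _ ≤ ∑ m ∈ Ioc ⌊x ^ (1 - ε)⌋₊ ⌊x⌋₊, (m : ℝ)⁻¹ * sumInvPrimeMultipliers ⌊x⌋₊ m ^ 2 :=
        sum_le_sum fun m hm => totient_mul_integral_primeCountingAP_sq_le (by linarith)
          (Nat.zero_lt_of_lt (mem_Ioc.1 hm).1)
    _ ≤ K * (ε * Real.log x + Real.log 2) + 512 :=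
        sum_Ioc_floor_rpow_inv_mul_sumInvPrimeMultipliers_sq_le hx hε.le hε'.le
    _ ≤ K * (2 * (ε * Real.log x)) + 512 * (ε * Real.log x) := by
        gcongr <;> linarith [Real.log_two_lt_d9]
    _ = (2 * K + 512) * (ε * Real.log x) := by ring
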